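/- A tracial $\mathrm{W}^*$-algebra $\mathcal{M}=(M,\tau)$ is a unital $\mathrm{C}^*$-algebra $M$ that is the dual of a Banach space, with a linear functional $\tau$ that is positive, unital, tracial, faithful and weak-$\star$ continuous. Write $L^\infty(\mathcal M)=M$, let $D_r^{\mathcal M}=\{x\in M:\|x\|\le r\}$ for $r>0$, and let $d^{\mathcal M}(x,y)=\tau((x-y)^*(x-y))^{1/2}$. The language $\mathcal{L}_{\mathrm{tr}}$ has one sort, interpreted as $M$, with domains of quantification $D_r$ ($r>0$), function symbols $+,\cdot,*$, multiplication by each $\lambda\in\mathbb{C}$, $0$, $1$ and the evaluation of each non-commutative polynomial, and relation symbols $\operatorname{Re}\operatorname{tr}$, $\operatorname{Im}\operatorname{tr}$ and $d$. The models of the theory $\mathrm{T}_{\mathrm{tr}}$ are the tracial $\mathrm{W}^*$-algebras. Quantifier-free formulas are obtained from $\operatorname{Re}\operatorname{tr}(t)$, $\operatorname{Im}\operatorname{tr}(t)$ and $d(s,t)$, for terms $s,t$, by iterated application of continuous functions $\mathbb{R}^n\to\mathbb{R}$. Let $I$ be a countable index set. A quantifier-free definable predicate in variables $(x_i)_{i\in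 I}$ is a family of functions $\phi^{\mathcal N}:L^\infty(\mathcal N)^I\to\mathbb{R}$, for $\mathcal N\models\mathrm{T}_{\mathrm{tr}}$, such that for every $\mathbf{s}\in(0,\infty)^I$ and $\varepsilon>0$ there is a quantifier-free formula $\psi$ in finitely many of the variables with $|\phi^{\mathcal N}(\mathbf Z)-\psi^{\mathcal N}(\mathbf Z)|<\varepsilon$ for all $\mathcal N\models\mathrm{T}_{\mathrm{tr}}$ and $\mathbf Z\in\prod_{i\in I}D_{s_i}^{\mathcal N}$. A quantifier-free definable function relative to $\mathrm{T}_{\mathrm{tr}}$ is a family of maps $\mathbf f^{\mathcal N}:L^\infty(\mathcal N)^{\mathbb N}\to L^\infty(\mathcal N)^{\mathbb N}$, for $\mathcal N\models\mathrm{T}_{\mathrm{tr}}$, such that (1) for every $\mathbf s\in(0,\infty)^{\mathbb N}$ there is $\mathbf s'\in(0,\infty)^{\mathbb N}$ such that, for every $\mathcal N$, $\mathbf f^{\mathcal N}$ maps $\prod_jD_{s_j}^{\mathcal N}$ into $\prod_jD_{s'_j}^{\mathcal N}$; and (2) for every quantifier-free definable predicate $\phi(\mathbf x',\tilde{\mathbf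 x})$ in two $\mathbb N$-tuples of variables, $\phi(\mathbf f(\mathbf x),\tilde{\mathbf x})$ is a quantifier-free definable predicate in $(\mathbf x,\tilde{\mathbf x})$. **Proposition.** Let $\mathcal M=(M,\tau)$ be a tracial $\mathrm{W}^*$-algebra, let $\mathbf r,\mathbf r'\in(0,\infty)^{\mathbb N}$, let $\mathbf X\in\prod_{j}D_{r_j}^{\mathcal M}$ generate $M$ (that is, the unital $*$-algebra generated by the $X_j$ is dense in $M$ for the strong operator topology of the standard representation on $L^2(M,\tau)$), and let $\mathbf Y\in\prod_jD_{r'_j}^{\mathcal M}$. Then there is a quantifier-free definable function $\mathbf f$ relative to $\mathrm{T}_{\mathrm{tr}}$ with $\mathbf Y=\mathbf f^{\mathcal M}(\mathbf X)$. Moreover $\mathbf f$ can be chosen so that, for every tracial $\mathrm{W}^*$-algebra $\mathcal N$, $\mathbf f^{\mathcal N}$ maps all of $L^\infty(\mathcal N)^{\mathbb N}$ into $\prod_{j}D_{r'_j}^{\mathcal N}$. -/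

import Mathlib

open scoped ComplexOrder

universe u

noncomputable section

/-- A tracial W*-algebra `(M, τ)`: a unital C*-algebra `M` that admits a predual, with a faithful
normal tracial state `τ`. Normality is weak-* continuity of `τ`, where the weak-* topology of `M` is
transported along an identification of `M` with the dual of a Banach space (such a predual is unique
up to isometry, so that it does not matter which one is used). -/
structure TracialWStarAlgebra : Type (u + 1) where
  /-- the underlying set `L^∞(M)` -/
  carrier : Type u
  [cstar : CStarAlgebra carrier]
  [wstar : WStarAlgebra carrier]
  /-- the trace `τ` -/
  tr : carrier →ₗ[ℂ] ℂ
  tr_star_mul_self_nonneg : ∀ x, 0 ≤ tr (star x * x)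
  tr_one : tr 1 = 1
  tr_mul_comm : ∀ x y, tr (x * y) = tr (y * x)
  tr_faithful : ∀ x, tr (star x * x) = 0 → x = 0
  tr_normal : ∃ (P : Type u) (_ : NormedAddCommGroup P) (_ : NormedSpace ℂ P)
    (_ : CompleteSpace P) (e : StrongDual ℂ P ≃ₗᵢ⋆[ℂ] carrier),
    Continuous fun φ : WeakDual ℂ P => tr (e (WeakDual.toStrongDual φ))

namespace TracialWStarAlgebra

instance : CoeSort TracialWStarAlgebra.{u} (Type u) := ⟨carrier⟩

instance (M : TracialWStarAlgebra.{u}) : CStarAlgebra M := M.cstar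

instance (M : TracialWStarAlgebra.{u}) : WStarAlgebra M := M.wstar

/-- The usual order of a C*-algebra: `x ≤ y` iff `y - x` is of the form `z* z`. -/
instance (M : TracialWStarAlgebra.{u}) : PartialOrder M := CStarAlgebra.spectralOrder M

instance (M : TracialWStarAlgebra.{u}) : StarOrderedRing M := CStarAlgebra.spectralOrderedRing M

variable (M : TracialWStarAlgebra.{u})

/-- The metric `d(x, y) = ‖x - y‖₂ = τ((x - y)* (x - y))^{1/2}`. -/
def l2Dist (x y : M) : ℝ := Real.sqrt (M.tr (star (x - y) * (x - y))).re

/-- The trace as a positive functional. -/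
def posTrace : M →ₚ[ℂ] ℂ :=
  PositiveLinearMap.mk₀ M.tr fun x hx => by
    obtain ⟨y, rfl⟩ := CStarAlgebra.nonneg_iff_eq_star_mul_self.mp hx
    exact M.tr_star_mul_self_nonneg y

/-- The Hilbert space `L²(M, τ)`: the completion of `M` for the inner product `τ(x* y)`. -/
abbrev L2 : Type u := M.posTrace.GNS

/-- The standard representation `π_τ` of `M` on `L²(M, τ)` by left multiplication, with values in
the bounded operators equipped with the strong operator topology (pointwise convergence). -/
def standardRep (x : M) : M.L2 →Lₚₜ[ℂ] M.L2 :=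
  ContinuousLinearMap.toPointwiseConvergenceCLM ℂ (RingHom.id ℂ) M.L2 M.L2
    (M.posTrace.gnsStarAlgHom x)

/-- The family `a` generates `M`: in the standard representation, the unital *-algebra generated by
`a` is dense in `M` for the strong operator topology. -/
def Generates {ι : Type*} (a : ι → M) : Prop :=
  ∀ x : M, M.standardRep x ∈
    closure (M.standardRep '' (StarAlgebra.adjoin ℂ (Set.range a) : Set M))

end TracialWStarAlgebra

/-! ### Terms and quantifier-free formulas of the language of tracial W*-algebras

There is one sort, with the domains of quantification `D_r`, `r > 0`, interpreted as the operator norm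
balls `{x | ‖x‖ ≤ r}`. Variables are indexed by a set `ι`. -/

/-- Terms of the language of tracial W*-algebras. -/
inductive TrTerm (ι : Type) : Type
  | var (i : ι) : TrTerm ι
  | zero : TrTerm ι
  | one : TrTerm ι
  | add (s t : TrTerm ι) : TrTerm ι
  | mul (s t : TrTerm ι) : TrTerm ι
  | star (t : TrTerm ι) : TrTerm ι
  | smul (c : ℂ) (t : TrTerm ι) : TrTerm ι
  /-- the symbol `t_p` of a non-commutative polynomial `p` in `n` variables, applied to terms -/
  | poly (n : ℕ) (p : FreeAlgebra ℂ (Fin n)) (t : Fin n → TrTerm ι) : TrTerm ι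

/-- Interpretation of a term in a tracial W*-algebra. -/
def TrTerm.eval {ι : Type} (M : TracialWStarAlgebra.{u}) (X : ι → M) : TrTerm ι → M
  | .var i => X i
  | .zero => 0
  | .one => 1
  | .add s t => s.eval M X + t.eval M X
  | .mul s t => s.eval M X * t.eval M X
  | .star t => Star.star (t.eval M X)
  | .smul c t => c • t.eval M X
  | .poly _ p t => FreeAlgebra.lift ℂ (fun i => (t i).eval M X) p

/-- Quantifier-free formulas: relation symbols (`Re tr`, `Im tr` and the metric `d`) applied to
terms, and continuous functions `ℝⁿ → ℝ` applied to quantifier-free formulas. -/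
inductive QFFormula (ι : Type) : Type
  | reTr (t : TrTerm ι) : QFFormula ι
  | imTr (t : TrTerm ι) : QFFormula ι
  | dist (s t : TrTerm ι) : QFFormula ι
  | conn (n : ℕ) (F : (Fin n → ℝ) → ℝ) (hF : Continuous F) (φ : Fin n → QFFormula ι) : QFFormula ι

/-- Interpretation of a quantifier-free formula in a tracial W*-algebra. -/
def QFFormula.eval {ι : Type} (M : TracialWStarAlgebra.{u}) (X : ι → M) : QFFormula ι → ℝ
  | .reTr t => (M.tr (t.eval M X)).re
  | .imTr t => (M.tr (t.eval M X)).im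
  | .dist s t => M.l2Dist (s.eval M X) (t.eval M X)
  | .conn _ F _ φ => F fun i => (φ i).eval M X

/-- A collection `φ` of real-valued functions of `ι`-tuples, one for each tracial W*-algebra, is a
quantifier-free definable predicate if on each product of norm balls it is approximated by a
quantifier-free formula, uniformly over all tracial W*-algebras. -/
def IsQFDefinablePredicate {ι : Type} (φ : ∀ M : TracialWStarAlgebra.{u}, (ι → M) → ℝ) : Prop :=
  ∀ r : ι → ℝ, (∀ i, 0 < r i) → ∀ ε : ℝ, 0 < ε → ∃ ψ : QFFormula ι,
    ∀ (M : TracialWStarAlgebra.{u}) (X : ι → M), (∀ i, ‖X i‖ ≤ r i) →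
      |φ M X - ψ.eval M X| < ε

/-- Quantifier-free definable functions from `ℕ`-tuples to `ℕ`-tuples, relative to the theory of
tracial W*-algebras. In a predicate in two `ℕ`-tuples of variables, the variables are indexed by
`ℕ ⊕ ℕ`. -/
structure IsQFDefinableFunction
    (f : ∀ M : TracialWStarAlgebra.{u}, (ℕ → M) → (ℕ → M)) : Prop where
  maps_domains : ∀ r : ℕ → ℝ, (∀ j, 0 < r j) → ∃ r' : ℕ → ℝ, (∀ j, 0 < r' j) ∧
    ∀ (M : TracialWStarAlgebra.{u}) (X : ℕ → M), (∀ j, ‖X j‖ ≤ r j) → ∀ j, ‖f M X j‖ ≤ r' j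
  comp_predicate : ∀ φ : ∀ M : TracialWStarAlgebra.{u}, (ℕ ⊕ ℕ → M) → ℝ,
    IsQFDefinablePredicate φ →
      IsQFDefinablePredicate fun (M : TracialWStarAlgebra.{u}) (Z : ℕ ⊕ ℕ → M) =>
        φ M (Sum.elim (f M fun j => Z (Sum.inl j)) fun j => Z (Sum.inr j))

end

/-! The map `h z = 2 z (1 + z* z)⁻¹` sends every tracial W*-algebra onto its unit ball and is
3-Lipschitz for `‖·‖₂`, with no restriction on `‖z‖` (`exists_unitBallMap_eq`,
`l2Norm_unitBallMap_sub_le`). Write `Y k = r' k • h (w k)`. Since `X` generates, terms `t k n` in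
`X` approximate `w k` in `‖·‖₂`; then `g k n = r' k • h (t k n)` is bounded by `r' k` in every
algebra and converges quickly to `Y k` at `X`. The cutoff `h` thus does the work of Kaplansky's
density theorem.

At other tuples the sequence `g k n` may diverge. A forced limit cures this: steps longer than `2⁻ⁿ`
are shortened, so the sequence becomes Cauchy at a rate uniform over all algebras, and it is
unchanged at `X`. The limit exists because norm balls are complete for `‖·‖₂` (`exists_l2_limit`),
the only place where normality of the trace enters.

Definability is checked on single coordinates. Maps that are bounded on products of balls and are
uniform `‖·‖₂`-limits of combinations of terms with predicate coefficients are closed under algebra,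
under `h` (by a Neumann series) and under forced limits. The predicate coefficients are needed for
the shortening factors. Substituting such maps in a definable predicate gives a definable predicate
(`predicate_comp`). -/

open TracialWStarAlgebra Filter Topology

noncomputable section

/-! ### The positive part of a norm ball as an intersection of norm balls -/

section CStar

variable {A : Type*} [CStarAlgebra A]

/-- Taking imaginary parts is contractive, so a spectral value `s` of the imaginary part satisfies
`(t + s)² ≤ c² + t²` for all real `t`, which forces `s = 0`. -/
lemma isSelfAdjoint_of_norm_add_smul_one_sq_le [Nontrivial A] {x : A} {c : ℝ}
    (h : ∀ t : ℝ, ‖x + ((t : ℂ) * Complex.I) • (1 : A)‖ ^ 2 ≤ c ^ 2 + t ^ 2) :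
    IsSelfAdjoint x := by
  set b : A := (imaginaryPart x : A) with hb
  have hbsa : IsSelfAdjoint b := (imaginaryPart x).2
  have h1 (t : ℝ) : ‖algebraMap ℝ A t + b‖ ^ 2 ≤ c ^ 2 + t ^ 2 := by
    refine le_trans ?_ (h t)
    have : (imaginaryPart (x + ((t : ℂ) * Complex.I) • (1 : A)) : A) = algebraMap ℝ A t + b := by
      rw [map_add, mul_comm, mul_smul, imaginaryPart_I_smul]
      have : (realPart ((t : ℂ) • (1 : A)) : A) = algebraMap ℝ A t := by
        rw [realPart_apply_coe, star_smul, star_one, Complex.star_def, Complex.conj_ofReal,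
          Algebra.algebraMap_eq_smul_one, ← two_smul ℝ, smul_smul, ← Complex.coe_smul]
        norm_num
      rw [AddSubgroup.coe_add, this, add_comm]
    gcongr
    rw [← this]
    exact imaginaryPart.norm_le (x + ((t : ℂ) * Complex.I) • (1 : A))
  have hb0 : b = 0 := by
    refine CFC.eq_zero_of_spectrum_subset_zero (R := ℝ) b ?_ hbsa
    intro s hs
    have h2 (t : ℝ) : (t + s) ^ 2 ≤ c ^ 2 + t ^ 2 := by
      refine le_trans ?_ (h1 t)
      have : t + s ∈ spectrum ℝ (algebraMap ℝ A t + b) := by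
        rw [add_comm t s]
        exact spectrum.add_mem_add_iff.2 hs
      have := spectrum.norm_le_norm_of_mem this
      rw [← sq_abs, ← Real.norm_eq_abs]
      gcongr
    by_contra hne
    have hs0 : s ≠ 0 := hne
    -- For this `t` the cross term `2 t s = 2 (c² + 1)` already exceeds `c²`.
    have := h2 ((c ^ 2 + 1) / s)
    have h3 : (c ^ 2 + 1) / s * s = c ^ 2 + 1 := div_mul_cancel₀ _ hs0
    nlinarith [sq_nonneg s, sq_nonneg c]
  have := realPart_add_I_smul_imaginaryPart x
  rw [← hb, hb0, smul_zero, add_zero] at this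
  rw [← this]
  exact (realPart x).2

lemma IsSelfAdjoint.norm_add_smul_one_sq_le [Nontrivial A] {x : A} (hx : IsSelfAdjoint x)
    {c : ℝ} (hc : ‖x‖ ≤ c) (t : ℝ) : ‖x + ((t : ℂ) * Complex.I) • (1 : A)‖ ^ 2 ≤ c ^ 2 + t ^ 2 := by
  rw [sq, ← CStarRing.norm_star_mul_self]
  have : star (x + ((t : ℂ) * Complex.I) • (1 : A)) * (x + ((t : ℂ) * Complex.I) • (1 : A))
      = x * x + ((t ^ 2 : ℝ) : ℂ) • (1 : A) := by
    simp only [star_add, hx.star_eq, star_smul, star_one, Complex.star_def, map_mul,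
      Complex.conj_ofReal, Complex.conj_I, add_mul, mul_add, smul_mul_assoc, mul_smul_comm, one_mul,
      mul_one]
    have : ((t : ℂ) * Complex.I) * ((t : ℂ) * -Complex.I) = ((t ^ 2 : ℝ) : ℂ) := by
      have := Complex.I_mul_I
      push_cast
      linear_combination (-(t : ℂ) ^ 2) * this
    rw [smul_add, smul_smul, this, mul_neg, neg_smul]
    abel
  rw [this]
  refine (norm_add_le _ _).trans ?_
  gcongr
  · refine (norm_mul_le _ _).trans ?_
    rw [← sq]
    gcongr
  · rw [norm_smul, Complex.norm_real, norm_one, mul_one, Real.norm_of_nonneg (sq_nonneg t)]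

/-- Every condition on the right bounds the norm of a translate of `x` or of `-x`. Such conditions
are weak-* closed for any predual, so the positive part of a ball is too. -/
lemma nonneg_and_norm_le_iff [Nontrivial A] [PartialOrder A] [StarOrderedRing A] {x : A} {c : ℝ}
    (hc : 0 ≤ c) :
    0 ≤ x ∧ ‖x‖ ≤ c ↔ ((∀ t : ℝ, ‖x + ((t : ℂ) * Complex.I) • (1 : A)‖ ^ 2 ≤ c ^ 2 + t ^ 2) ∧
      ‖algebraMap ℝ A c - x‖ ≤ c) ∧ ‖x‖ ≤ c := by
  refine and_congr_left fun hx => ?_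
  lift c to NNReal using hc
  have key : IsSelfAdjoint x → (0 ≤ x ↔ ‖algebraMap ℝ A c - x‖ ≤ c) := fun hsa => by
    have := SpectrumRestricts.nnreal_iff_nnnorm hsa (t := c) (by exact_mod_cast hx)
    rw [nonneg_iff_isSelfAdjoint_and_quasispectrumRestricts, and_iff_right hsa]
    exact this
  constructor
  · intro h0
    have hsa : IsSelfAdjoint x := .of_nonneg h0
    exact ⟨hsa.norm_add_smul_one_sq_le hx, (key hsa).1 h0⟩
  · rintro ⟨h1, h2⟩
    exact (key (isSelfAdjoint_of_norm_add_smul_one_sq_le h1)).2 h2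

end CStar

namespace TracialWStarAlgebra

variable (M : TracialWStarAlgebra.{u})

instance : Nontrivial M := by
  refine ⟨0, 1, fun h => ?_⟩
  have := M.tr_one
  rw [← h, map_zero] at this
  exact zero_ne_one this

/-! ### The norm `‖x‖₂ = τ(x* x)^{1/2}` -/

/-- The norm `‖x‖₂ = τ(x* x)^{1/2}`. -/
def l2Norm (x : M) : ℝ := ‖M.posTrace.toPreGNS x‖

variable {M}

lemma l2Norm_eq_sqrt (x : M) : M.l2Norm x = Real.sqrt (M.tr (star x * x)).re := rfl

lemma l2Dist_eq_l2Norm (x y : M) : M.l2Dist x y = M.l2Norm (x - y) := rfl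

lemma l2Norm_sq (x : M) : M.l2Norm x ^ 2 = (M.tr (star x * x)).re := by
  rw [l2Norm_eq_sqrt, Real.sq_sqrt (M.tr_star_mul_self_nonneg x).1]

lemma l2Norm_nonneg (x : M) : 0 ≤ M.l2Norm x := norm_nonneg _

@[simp] lemma l2Norm_zero : M.l2Norm (0 : M) = 0 := by simp [l2Norm]

lemma l2Norm_add_le (x y : M) : M.l2Norm (x + y) ≤ M.l2Norm x + M.l2Norm y := by
  simpa [l2Norm] using norm_add_le (M.posTrace.toPreGNS x) (M.posTrace.toPreGNS y)

lemma l2Norm_neg (x : M) : M.l2Norm (-x) = M.l2Norm x := by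
  simp [l2Norm]

lemma l2Norm_sub_comm (x y : M) : M.l2Norm (x - y) = M.l2Norm (y - x) := by
  rw [← l2Norm_neg, neg_sub]

lemma l2Norm_sub_le (x y z : M) : M.l2Norm (x - z) ≤ M.l2Norm (x - y) + M.l2Norm (y - z) := by
  simpa using l2Norm_add_le (x - y) (y - z)

lemma l2Norm_smul (c : ℂ) (x : M) : M.l2Norm (c • x) = ‖c‖ * M.l2Norm x := by
  simp [l2Norm, norm_smul]

lemma l2Norm_star (x : M) : M.l2Norm (star x) = M.l2Norm x := by
  rw [l2Norm_eq_sqrt, l2Norm_eq_sqrt, star_star, M.tr_mul_comm]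

lemma l2Norm_mul_le_left (a x : M) : M.l2Norm (a * x) ≤ ‖a‖ * M.l2Norm x := by
  refine (M.posTrace.leftMulMapPreGNS a).le_of_opNorm_le ?_ (M.posTrace.toPreGNS x)
  exact LinearMap.mkContinuous_norm_le _ (norm_nonneg _) _

lemma l2Norm_mul_le_right (x a : M) : M.l2Norm (x * a) ≤ M.l2Norm x * ‖a‖ := by
  rw [← l2Norm_star, star_mul, mul_comm, ← norm_star a, ← l2Norm_star x]
  exact l2Norm_mul_le_left _ _

lemma l2Norm_one : M.l2Norm (1 : M) = 1 := by
  simp [l2Norm_eq_sqrt, M.tr_one]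

lemma l2Norm_le_norm (x : M) : M.l2Norm x ≤ ‖x‖ := by
  simpa [l2Norm_one] using l2Norm_mul_le_left x 1

lemma norm_tr_le (x : M) : ‖M.tr x‖ ≤ M.l2Norm x := by
  have := norm_inner_le_norm (𝕜 := ℂ) (M.posTrace.toPreGNS 1) (M.posTrace.toPreGNS x)
  rw [PositiveLinearMap.preGNS_inner_def] at this
  change ‖M.tr (star 1 * x)‖ ≤ M.l2Norm 1 * M.l2Norm x at this
  simpa [l2Norm_one] using this

lemma eq_zero_of_l2Norm_eq_zero {x : M} (h : M.l2Norm x = 0) : x = 0 := by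
  refine M.tr_faithful x (Complex.ext ?_ ?_)
  · rw [← l2Norm_sq, h]; simp
  · exact (M.tr_star_mul_self_nonneg x).2.symm

lemma tr_nonneg {x : M} (hx : 0 ≤ x) : 0 ≤ M.tr x := by
  obtain ⟨y, rfl⟩ := CStarAlgebra.nonneg_iff_eq_star_mul_self.mp hx
  exact M.tr_star_mul_self_nonneg y

lemma tr_re_le_l2Norm (x : M) : (M.tr x).re ≤ M.l2Norm x :=
  (Complex.re_le_norm _).trans (norm_tr_le x)

/-- This is the trace of `x² ≤ ‖x‖ x`. On bounded positive elements, small trace therefore means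
small `‖·‖₂`. -/
lemma l2Norm_sq_le_of_nonneg {x : M} (hx : 0 ≤ x) : M.l2Norm x ^ 2 ≤ ‖x‖ * (M.tr x).re := by
  rw [l2Norm_sq, (IsSelfAdjoint.of_nonneg hx).star_eq]
  have h : x * x ≤ (‖x‖ : ℂ) • x := by
    obtain ⟨y, rfl⟩ := CStarAlgebra.nonneg_iff_eq_star_mul_self.mp hx
    have := CStarAlgebra.star_left_conjugate_le_norm_smul (a := y) (b := y * star y)
    rw [CStarRing.norm_self_mul_star, ← CStarRing.norm_star_mul_self] at this
    rw [Complex.coe_smul]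
    simpa [mul_assoc] using this
  have := (tr_nonneg (sub_nonneg.2 h)).1
  simpa using this

/-- The products `a⁺ a⁻` and `a⁻ a⁺` vanish, so `a²` is the sum of the squares of the two parts. -/
lemma l2Norm_posPart_le {a : M} (ha : IsSelfAdjoint a) : M.l2Norm a⁺ ≤ M.l2Norm a := by
  refine abs_le_of_sq_le_sq' ?_ (l2Norm_nonneg _) |>.2
  rw [l2Norm_sq, l2Norm_sq, ha.star_eq, (CFC.posPart_nonneg a).isSelfAdjoint.star_eq]
  have h : a * a = a⁺ * a⁺ + a⁻ * a⁻ := by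
    conv_lhs => rw [← CFC.posPart_sub_negPart a ha]
    rw [sub_mul, mul_sub, mul_sub, CFC.posPart_mul_negPart, CFC.negPart_mul_posPart]
    abel
  have h2 : (0 : ℂ) ≤ M.tr (a⁻ * a⁻) := by
    have := M.tr_star_mul_self_nonneg a⁻
    rwa [(CFC.negPart_nonneg a).isSelfAdjoint.star_eq] at this
  have := h2.1
  rw [h, map_add, Complex.add_re]
  simpa using this

lemma l2Norm_negPart_le {a : M} (ha : IsSelfAdjoint a) : M.l2Norm a⁻ ≤ M.l2Norm a := by
  rw [← CFC.posPart_neg, ← l2Norm_neg a]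
  exact l2Norm_posPart_le ha.neg

lemma l2Norm_realPart_le (x : M) : M.l2Norm (realPart x : M) ≤ M.l2Norm x := by
  rw [realPart_apply_coe, ← Complex.coe_smul, l2Norm_smul]
  have := l2Norm_add_le x (star x)
  rw [l2Norm_star] at this
  norm_num
  linarith

lemma l2Norm_imaginaryPart_le (x : M) : M.l2Norm (imaginaryPart x : M) ≤ M.l2Norm x := by
  have h : (imaginaryPart x : M) = (realPart (-Complex.I • x) : M) := by
    rw [neg_smul, map_neg, realPart_I_smul, neg_neg]
  rw [h]
  refine (l2Norm_realPart_le _).trans ?_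
  rw [l2Norm_smul]
  simp

end TracialWStarAlgebra

end

noncomputable section

namespace TracialWStarAlgebra

variable {M : TracialWStarAlgebra.{u}}

/-! ### Completeness of norm balls for `‖·‖₂` -/

section Predual

variable {P : Type u} [NormedAddCommGroup P] [NormedSpace ℂ P]
  (e : StrongDual ℂ P ≃ₗᵢ⋆[ℂ] M)

/-- The identification of `M` with the dual of a Banach space, for the weak-* topology. -/
def ofWeakDual (φ : WeakDual ℂ P) : M := e (WeakDual.toStrongDual φ)

lemma ofWeakDual_injective : Function.Injective (ofWeakDual e) :=
  e.injective.comp WeakDual.toStrongDual.injective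

lemma ofWeakDual_sub (φ ψ : WeakDual ℂ P) :
    ofWeakDual e (φ - ψ) = ofWeakDual e φ - ofWeakDual e ψ := by
  simp [ofWeakDual]

lemma ofWeakDual_sub_add_I_smul (p q r s : WeakDual ℂ P) :
    ofWeakDual e (p - q + Complex.I • (r - s)) =
      (ofWeakDual e p - ofWeakDual e q) + (-Complex.I) • (ofWeakDual e r - ofWeakDual e s) := by
  simp only [ofWeakDual, map_add, map_sub, map_smul, LinearIsometryEquiv.map_smulₛₗ,
    Complex.conj_I]

lemma isCompact_ofWeakDual_norm_sub_le (a : M) (c : ℝ) :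
    IsCompact {φ | ‖ofWeakDual e φ - a‖ ≤ c} := by
  convert! WeakDual.isCompact_closedBall (e.symm a) c using 1
  ext φ
  simp only [Set.mem_ofPred_eq, Set.mem_preimage, Metric.mem_closedBall, dist_eq_norm, ofWeakDual]
  rw [← e.norm_map, map_sub, e.apply_symm_apply]

lemma isClosed_ofWeakDual_norm_sub_le (a : M) (c : ℝ) :
    IsClosed {φ | ‖ofWeakDual e φ - a‖ ≤ c} :=
  (isCompact_ofWeakDual_norm_sub_le e a c).isClosed

lemma isCompact_ofWeakDual_nonneg {c : ℝ} (hc : 0 ≤ c) :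
    IsCompact {φ | 0 ≤ ofWeakDual e φ ∧ ‖ofWeakDual e φ‖ ≤ c} := by
  have h1 : IsCompact {φ | ‖ofWeakDual e φ‖ ≤ c} := by
    simpa using isCompact_ofWeakDual_norm_sub_le e 0 c
  refine h1.of_isClosed_subset ?_ fun φ h => h.2
  simp only [nonneg_and_norm_le_iff hc, Set.ofPred_and, Set.ofPred_forall]
  refine ((isClosed_iInter fun t => ?_).inter ?_).inter h1.isClosed
  · have := isClosed_ofWeakDual_norm_sub_le e (-(((t : ℂ) * Complex.I) • (1 : M)))
      (Real.sqrt (c ^ 2 + t ^ 2))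
    simpa only [sub_neg_eq_add, Real.le_sqrt (norm_nonneg _) (by positivity : 0 ≤ c ^ 2 + t ^ 2)]
      using this
  · simpa only [norm_sub_rev] using isClosed_ofWeakDual_norm_sub_le e (algebraMap ℝ M c) c

/-- Linear combinations of four positive elements of norm at most `c` and of total trace at
most `ε`. -/
def l1Small (c ε : ℝ) : Set (WeakDual ℂ P) :=
  (fun p : Fin 4 → WeakDual ℂ P => p 0 - p 1 + Complex.I • (p 2 - p 3)) ''
    {p | (∀ i, 0 ≤ ofWeakDual e (p i) ∧ ‖ofWeakDual e (p i)‖ ≤ c) ∧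
      ∑ i, (M.tr (ofWeakDual e (p i))).re ≤ ε}

/-- Weak-* closedness of `‖·‖₂`-balls is not immediate from continuity of the trace alone. The
substitute `l1Small` is a continuous image of a compact set, and on norm balls it is comparable with
`‖·‖₂`-balls by the next two lemmas. -/
lemma isClosed_l1Small (he : Continuous fun φ => M.tr (ofWeakDual e φ)) {c : ℝ} (hc : 0 ≤ c)
    (ε : ℝ) : IsClosed (l1Small e c ε) := by
  refine IsCompact.isClosed (IsCompact.image ?_ (by fun_prop))
  rw [Set.ofPred_and]
  refine IsCompact.inter_right ?_ ?_
  · simpa [Set.pi] using isCompact_univ_pi fun _ : Fin 4 => isCompact_ofWeakDual_nonneg e hc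
  · refine isClosed_le (continuous_finsetSum _ fun i _ => ?_) continuous_const
    exact Complex.continuous_re.comp (he.comp (continuous_apply i))

lemma mem_l1Small {φ : WeakDual ℂ P} {c : ℝ} (h : ‖ofWeakDual e φ‖ ≤ c) :
    φ ∈ l1Small e c (4 * M.l2Norm (ofWeakDual e φ)) := by
  set x := ofWeakDual e φ
  let a : M := (realPart x : M)
  let b : M := (imaginaryPart x : M)
  have ha : IsSelfAdjoint a := (realPart x).2
  have hb : IsSelfAdjoint b := (imaginaryPart x).2
  let E' : M → WeakDual ℂ P := fun y => StrongDual.toWeakDual (e.symm y)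
  have hE (y : M) : ofWeakDual e (E' y) = y := e.apply_symm_apply y
  have hna : ‖a‖ ≤ c := (realPart.norm_le x).trans h
  have hnb : ‖b‖ ≤ c := (imaginaryPart.norm_le x).trans h
  -- `b⁻` precedes `b⁺` because `e` is conjugate-linear and turns `I` into `-I`.
  refine ⟨![E' a⁺, E' a⁻, E' b⁻, E' b⁺], ⟨?_, ?_⟩, ?_⟩
  · intro i
    fin_cases i
    · simpa [hE] using ⟨CFC.posPart_nonneg a, (CStarAlgebra.norm_posPart_le a).trans hna⟩
    · simpa [hE] using ⟨CFC.negPart_nonneg a, (CStarAlgebra.norm_negPart_le a).trans hna⟩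
    · simpa [hE] using ⟨CFC.negPart_nonneg b, (CStarAlgebra.norm_negPart_le b).trans hnb⟩
    · simpa [hE] using ⟨CFC.posPart_nonneg b, (CStarAlgebra.norm_posPart_le b).trans hnb⟩
  · simp only [Fin.sum_univ_four, Matrix.cons_val, hE]
    have h1 := (tr_re_le_l2Norm a⁺).trans ((l2Norm_posPart_le ha).trans (l2Norm_realPart_le x))
    have h2 := (tr_re_le_l2Norm a⁻).trans ((l2Norm_negPart_le ha).trans (l2Norm_realPart_le x))
    have h3 := (tr_re_le_l2Norm b⁻).trans ((l2Norm_negPart_le hb).trans (l2Norm_imaginaryPart_le x))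
    have h4 := (tr_re_le_l2Norm b⁺).trans ((l2Norm_posPart_le hb).trans (l2Norm_imaginaryPart_le x))
    linarith
  · refine ofWeakDual_injective e ?_
    simp only [Matrix.cons_val, ofWeakDual_sub_add_I_smul, hE]
    rw [CFC.posPart_sub_negPart a ha, ← neg_sub b⁺, CFC.posPart_sub_negPart b hb, smul_neg,
      neg_smul, neg_neg]
    exact realPart_add_I_smul_imaginaryPart x

lemma l2Norm_le_of_mem_l1Small {φ : WeakDual ℂ P} {c ε : ℝ} (h : φ ∈ l1Small e c ε) :
    M.l2Norm (ofWeakDual e φ) ≤ 4 * Real.sqrt (c * ε) := by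
  obtain ⟨p, ⟨hp, hε⟩, rfl⟩ := h
  have h1 (i : Fin 4) : M.l2Norm (ofWeakDual e (p i)) ≤ Real.sqrt (c * ε) := by
    refine Real.le_sqrt_of_sq_le ((l2Norm_sq_le_of_nonneg (hp i).1).trans ?_)
    have h2 : (M.tr (ofWeakDual e (p i))).re ≤ ε :=
      (Finset.single_le_sum (f := fun i => (M.tr (ofWeakDual e (p i))).re)
        (fun j _ => (tr_nonneg (hp j).1).1) (Finset.mem_univ i)).trans hε
    exact mul_le_mul (hp i).2 h2 (tr_nonneg (hp i).1).1 ((norm_nonneg _).trans (hp i).2)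
  simp only [ofWeakDual_sub_add_I_smul, sub_eq_add_neg (ofWeakDual e _)]
  have h3 := l2Norm_add_le (ofWeakDual e (p 0) + -ofWeakDual e (p 1))
    ((-Complex.I) • (ofWeakDual e (p 2) + -ofWeakDual e (p 3)))
  have h4 := l2Norm_add_le (ofWeakDual e (p 0)) (-ofWeakDual e (p 1))
  have h5 := l2Norm_add_le (ofWeakDual e (p 2)) (-ofWeakDual e (p 3))
  rw [l2Norm_smul] at h3
  rw [l2Norm_neg] at h4 h5
  simp only [norm_neg, Complex.norm_I, one_mul] at h3
  linarith [h1 0, h1 1, h1 2, h1 3]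

end Predual

/-- Norm balls are complete for `‖·‖₂`. -/
theorem exists_l2_limit {c : ℝ} {x : ℕ → M} (hx : ∀ n, ‖x n‖ ≤ c) {b : ℕ → ℝ}
    (hb : Tendsto b atTop (𝓝 0)) (hxb : ∀ n m, n ≤ m → M.l2Norm (x n - x m) ≤ b n) :
    ∃ y : M, ‖y‖ ≤ c ∧ ∀ n, M.l2Norm (x n - y) ≤ b n := by
  obtain ⟨P, _, _, _, e, he⟩ := M.tr_normal
  change Continuous fun φ => M.tr (ofWeakDual e φ) at he
  have hc : 0 ≤ c := (norm_nonneg _).trans (hx 0)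
  let φ : ℕ → WeakDual ℂ P := fun n => StrongDual.toWeakDual (e.symm (x n))
  have hφ (n : ℕ) : ofWeakDual e (φ n) = x n := e.apply_symm_apply (x n)
  have hK := isCompact_ofWeakDual_norm_sub_le e 0 c
  simp only [sub_zero] at hK
  -- By Banach-Alaoglu there is a weak-* cluster point; it will be the limit.
  obtain ⟨ψ, hψ, hcl⟩ := hK.exists_mapClusterPt (f := atTop) (u := φ)
    (tendsto_principal.2 (.of_forall fun n => by simpa [hφ] using hx n))
  have hb4 : ∀ ⦃s t : ℝ⦄, s ≤ t → l1Small e (c + c) s ⊆ l1Small e (c + c) t :=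
    fun s t hst => Set.image_mono fun p hp => ⟨hp.1, hp.2.trans hst⟩
  -- The differences `x n - x m`, of norm at most `c + c`, lie in a fixed closed set for `m ≥ n`,
  -- hence so does `x n - ψ`. This rate is weaker than `b n`; the triangle inequality through `x m`
  -- with `m → ∞` recovers `b n`.
  have key (n : ℕ) : M.l2Norm (x n - ofWeakDual e ψ) ≤ 4 * Real.sqrt ((c + c) * (4 * b n)) := by
    have hmem : φ n - ψ ∈ l1Small e (c + c) (4 * b n) := by
      refine ((isClosed_l1Small e he (add_nonneg hc hc) _).preimage
        (by fun_prop : Continuous fun ψ => φ n - ψ)).mem_of_mapClusterPt hcl ?_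
      filter_upwards [eventually_ge_atTop n] with m hm
      have h1 : ofWeakDual e (φ n - φ m) = x n - x m := by rw [ofWeakDual_sub, hφ, hφ]
      refine hb4 ?_ (mem_l1Small e (φ := φ n - φ m) ?_)
      · rw [h1]; linarith [hxb n m hm]
      · rw [h1]; exact (norm_sub_le _ _).trans (add_le_add (hx n) (hx m))
    rw [← hφ n, ← ofWeakDual_sub]
    exact l2Norm_le_of_mem_l1Small e hmem
  refine ⟨ofWeakDual e ψ, hψ, fun n => ?_⟩
  have hlim : Tendsto (fun m => b n + 4 * Real.sqrt ((c + c) * (4 * b m))) atTop (𝓝 (b n)) := by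
    have h1 : Tendsto (fun m => (c + c) * (4 * b m)) atTop (𝓝 0) := by
      simpa using (hb.const_mul 4).const_mul (c + c)
    simpa using ((Real.continuous_sqrt.tendsto _).comp h1).const_mul 4 |>.const_add (b n)
  refine ge_of_tendsto hlim ?_
  filter_upwards [eventually_ge_atTop n] with m hm
  exact (l2Norm_sub_le _ (x m) _).trans (add_le_add (hxb n m hm) (key m))

end TracialWStarAlgebra

end

noncomputable section

/-! ### A Lipschitz map onto the unit ball -/

section Cutoff

variable {A : Type*} [CStarAlgebra A]

/-- The element `(1 + z* z)⁻¹`. -/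
def invOneAddSq (z : A) : A := Ring.inverse (1 + star z * z)

/-- The map `z ↦ 2 z (1 + z* z)⁻¹` onto the unit ball. -/
def unitBallMap (z : A) : A := (2 : ℂ) • (z * invOneAddSq z)

variable [PartialOrder A] [StarOrderedRing A]

lemma isUnit_one_add_star_mul_self (z : A) : IsUnit (1 + star z * z) :=
  CStarAlgebra.isUnit_of_le 1 (le_add_of_nonneg_right (star_mul_self_nonneg z))

lemma invOneAddSq_mul_cancel (z : A) : invOneAddSq z * (1 + star z * z) = 1 :=
  Ring.inverse_mul_cancel _ (isUnit_one_add_star_mul_self z)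

lemma mul_invOneAddSq_cancel (z : A) : (1 + star z * z) * invOneAddSq z = 1 :=
  Ring.mul_inverse_cancel _ (isUnit_one_add_star_mul_self z)

lemma invOneAddSq_eq_of_mul_eq_one {z a : A} (h : (1 + star z * z) * a = 1) :
    invOneAddSq z = a := by
  rw [← mul_one (invOneAddSq z), ← h, ← mul_assoc, invOneAddSq_mul_cancel, one_mul]

lemma invOneAddSq_nonneg_and_le_one (z : A) : 0 ≤ invOneAddSq z ∧ invOneAddSq z ≤ 1 := by
  obtain ⟨v, hv⟩ := isUnit_one_add_star_mul_self z
  have h1 : (1 : A) ≤ v := by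
    rw [hv]; exact le_add_of_nonneg_right (star_mul_self_nonneg z)
  rw [invOneAddSq, ← hv, Ring.inverse_unit]
  exact ⟨CFC.inv_nonneg_of_nonneg v (zero_le_one.trans h1), CStarAlgebra.inv_le_one h1⟩

lemma norm_invOneAddSq_le_one (z : A) : ‖invOneAddSq z‖ ≤ 1 :=
  (CStarAlgebra.norm_le_one_iff_of_nonneg _ (invOneAddSq_nonneg_and_le_one z).1).2
    (invOneAddSq_nonneg_and_le_one z).2

lemma isSelfAdjoint_invOneAddSq (z : A) : IsSelfAdjoint (invOneAddSq z) :=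
  .of_nonneg (invOneAddSq_nonneg_and_le_one z).1

lemma star_mul_self_mul_invOneAddSq (z : A) : star z * z * invOneAddSq z = 1 - invOneAddSq z := by
  have := mul_invOneAddSq_cancel z
  rw [add_mul, one_mul] at this
  rw [← this]; abel

/-- Follows from `z (1 + z* z) = (1 + z z*) z`. -/
lemma invOneAddSq_star_mul (z : A) : invOneAddSq (star z) * z = z * invOneAddSq z := by
  have h1 := invOneAddSq_mul_cancel (star z)
  have h2 := mul_invOneAddSq_cancel z
  rw [star_star] at h1
  calc invOneAddSq (star z) * z
    _ = invOneAddSq (star z) * (z * ((1 + star z * z) * invOneAddSq z)) := by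
        rw [h2, mul_one]
    _ = (invOneAddSq (star z) * (1 + z * star z)) * (z * invOneAddSq z) := by noncomm_ring
    _ = z * invOneAddSq z := by rw [h1, one_mul]

/-- With `r = (1 + z* z)⁻¹`, the square of the modulus is `4 r (1 - r) = 1 - (1 - 2 r)²`. -/
lemma norm_unitBallMap_le_one (z : A) : ‖unitBallMap z‖ ≤ 1 := by
  set r := invOneAddSq z with hr
  have hsa : star r = r := isSelfAdjoint_invOneAddSq z
  have h1 : star (unitBallMap z) * unitBallMap z =
      1 - star (1 - (2 : ℂ) • r) * (1 - (2 : ℂ) • r) := by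
    have h2 : star (unitBallMap z) * unitBallMap z = (4 : ℂ) • (r * (star z * z * r)) := by
      rw [unitBallMap, ← hr, star_smul, star_mul, hsa, smul_mul_smul_comm]
      norm_num [mul_assoc]
    rw [h2, star_mul_self_mul_invOneAddSq, ← hr, star_sub, star_smul, hsa, star_one]
    have : (2 : ℂ) • r = r + r := two_smul ℂ r
    have h4 : (4 : ℂ) • (r * (1 - r)) = 2 • (2 • (r * (1 - r))) := by
      rw [smul_smul, ← Nat.cast_smul_eq_nsmul ℂ]; norm_num
    simp only [Complex.star_def, Complex.conj_ofNat, this, h4]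
    noncomm_ring
  have h2 : ‖star (unitBallMap z) * unitBallMap z‖ ≤ 1 := by
    rw [CStarAlgebra.norm_le_one_iff_of_nonneg _ (star_mul_self_nonneg _), h1]
    exact sub_le_self _ (star_mul_self_nonneg _)
  rw [CStarRing.norm_star_mul_self] at h2
  nlinarith [norm_nonneg (unitBallMap z)]

/-- A resolvent identity: insert `(1 + w* w)(1 + w* w)⁻¹` on the right of one term and `(1 + z
z*)⁻¹(1 + z z*)` on the left of the other. All factors around `z - w` and its adjoint are
contractions. -/
lemma unitBallMap_sub (z w : A) :
    unitBallMap z - unitBallMap w = (2 : ℂ) • (invOneAddSq (star z) * (z - w) * invOneAddSq w) +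
      (2⁻¹ : ℂ) • (unitBallMap z * star (w - z) * unitBallMap w) := by
  have h1 := invOneAddSq_mul_cancel (star z)
  have h2 := mul_invOneAddSq_cancel w
  have h3 := invOneAddSq_star_mul z
  rw [star_star] at h1
  have h4 : z * invOneAddSq z - w * invOneAddSq w = invOneAddSq (star z) * (z - w) * invOneAddSq w +
      (z * invOneAddSq z) * star (w - z) * (w * invOneAddSq w) := by
    rw [← h3]
    calc invOneAddSq (star z) * z - w * invOneAddSq w =
        invOneAddSq (star z) * z * ((1 + star w * w) * invOneAddSq w) -
          (invOneAddSq (star z) * (1 + z * star z)) * (w * invOneAddSq w) := by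
          rw [h1, h2, one_mul, mul_one]
      _ = _ := by rw [star_sub]; noncomm_ring
  rw [unitBallMap, unitBallMap, ← smul_sub, h4, smul_add]
  congr 1
  simp only [smul_mul_assoc, mul_smul_comm, smul_smul]
  norm_num

/-- Every element of the unit ball is in the range of `unitBallMap`. -/
lemma exists_unitBallMap_eq {y : A} (hy : ‖y‖ ≤ 1) : ∃ w : A, unitBallMap w = y := by
  have hy1 : star y * y ≤ 1 := by
    rw [← CStarAlgebra.norm_le_one_iff_of_nonneg _ (star_mul_self_nonneg _),
      CStarRing.norm_star_mul_self]
    nlinarith [norm_nonneg y]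
  -- The preimage is `y (1 + √(1 - y* y))⁻¹`, modelled on the scalar solution of `y = 2 w / (1 +
  -- w²)`.
  set s : A := CFC.sqrt (1 - star y * y) with hs
  have hs0 : 0 ≤ s := CFC.sqrt_nonneg _
  have hss : s * s = 1 - star y * y := CFC.sqrt_mul_sqrt_self _ (sub_nonneg.2 hy1)
  obtain ⟨v, hv⟩ : IsUnit (1 + s) := CStarAlgebra.isUnit_of_le 1 (le_add_of_nonneg_right hs0)
  set c : A := (↑v⁻¹ : A) with hc
  have hcv : c * (1 + s) = 1 := by rw [← hv]; exact v.inv_mul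
  have hvc : (1 + s) * c = 1 := by rw [← hv]; exact v.mul_inv
  have hvn : 0 ≤ (v : A) := by rw [hv]; exact add_nonneg zero_le_one hs0
  have hcsa : star c = c := (IsSelfAdjoint.of_nonneg (CFC.inv_nonneg_of_nonneg v hvn))
  have hyy : star y * y = (1 + s) * (1 - s) := by
    have : star y * y = 1 - s * s := by rw [hss]; abel
    rw [this]; noncomm_ring
  have hw : 1 + star (y * c) * (y * c) = (2 : ℂ) • c := by
    calc 1 + star (y * c) * (y * c) = 1 + c * (star y * y) * c := by
          rw [star_mul, hcsa]; noncomm_ring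
      _ = 1 + (c * (1 + s)) * (1 - s) * c := by rw [hyy]; noncomm_ring
      _ = (1 + s) * c + (1 - s) * c := by rw [hcv, hvc, one_mul]
      _ = (2 : ℂ) • c := by rw [two_smul]; noncomm_ring
  refine ⟨y * c, ?_⟩
  have hr : invOneAddSq (y * c) = (2⁻¹ : ℂ) • (1 + s) := by
    refine invOneAddSq_eq_of_mul_eq_one ?_
    rw [hw, smul_mul_smul_comm, hcv]
    norm_num
  rw [unitBallMap, hr, mul_smul_comm, smul_smul, mul_assoc, hcv]
  norm_num

/-- The Neumann series of `(1 + z* z)⁻¹` around a large multiple of the identity. -/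
lemma norm_invOneAddSq_sub_sum_le [Nontrivial A] {z : A} {T : ℝ} (hz : ‖z‖ ^ 2 ≤ T) (n : ℕ) :
    ‖invOneAddSq z - ((1 + T)⁻¹ : ℂ) • ∑ k ∈ Finset.range n,
      (((1 + T)⁻¹ : ℂ) • ((T : ℂ) • 1 - star z * z)) ^ k‖ ≤ (T / (1 + T)) ^ n := by
  have hT : 0 ≤ T := (sq_nonneg _).trans hz
  have hT' : (1 + T : ℂ) ≠ 0 := by exact_mod_cast (by positivity : (1 + T : ℝ) ≠ 0)
  set a : A := ((1 + T)⁻¹ : ℂ) • ((T : ℂ) • 1 - star z * z) with ha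
  have hna : ‖a‖ ≤ T / (1 + T) := by
    have hTn : ‖star z * z‖ ≤ T := by rwa [CStarRing.norm_star_mul_self, ← sq]
    have h0 : ‖(T : ℂ) • (1 : A) - star z * z‖ ≤ T := by
      have h := (nonneg_and_norm_le_iff hT).1 ⟨star_mul_self_nonneg z, hTn⟩
      have := h.1.2
      rwa [Algebra.algebraMap_eq_smul_one, ← Complex.coe_smul] at this
    rw [ha, norm_smul, div_eq_inv_mul]
    have : ‖((1 + T)⁻¹ : ℂ)‖ = (1 + T)⁻¹ := by
      rw [norm_inv]
      congr 1
      exact_mod_cast Complex.norm_of_nonneg (by positivity : 0 ≤ 1 + T)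
    rw [this]
    gcongr
  have h1a : 1 + star z * z = (1 + T : ℂ) • (1 - a) := by
    rw [ha, smul_sub, smul_smul, mul_inv_cancel₀ hT', one_smul, add_smul, one_smul]
    abel
  have hgeom : (1 - a) * ∑ k ∈ Finset.range n, a ^ k = 1 - a ^ n := mul_neg_geom_sum a n
  -- As `1 + z* z = (1 + T)(1 - a)`, the remainder of the geometric series is the inverse times `a ^
  -- n`.
  have key : invOneAddSq z - ((1 + T)⁻¹ : ℂ) • ∑ k ∈ Finset.range n, a ^ k =
      invOneAddSq z * a ^ n := by
    have : ((1 + T)⁻¹ : ℂ) • ∑ k ∈ Finset.range n, a ^ k =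
        invOneAddSq z * ((1 + star z * z) * ((1 + T)⁻¹ : ℂ) • ∑ k ∈ Finset.range n, a ^ k) := by
      rw [← mul_assoc, invOneAddSq_mul_cancel, one_mul]
    rw [this, h1a, smul_mul_smul_comm, hgeom, mul_inv_cancel₀ hT', one_smul]
    noncomm_ring
  rw [key]
  calc ‖invOneAddSq z * a ^ n‖ ≤ 1 * (T / (1 + T)) ^ n := by
        refine (norm_mul_le _ _).trans ?_
        gcongr
        · exact norm_invOneAddSq_le_one z
        · exact (norm_pow_le a n).trans (by gcongr)
    _ = _ := one_mul _

end Cutoff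

namespace TracialWStarAlgebra

/-- The two terms of `unitBallMap_sub` give the constant `2 + 1/2`, rounded up to 3. -/
lemma l2Norm_unitBallMap_sub_le {M : TracialWStarAlgebra.{u}} (z w : M) :
    M.l2Norm (unitBallMap z - unitBallMap w) ≤ 3 * M.l2Norm (z - w) := by
  have h0 := l2Norm_nonneg (z - w)
  have h1 : M.l2Norm (invOneAddSq (star z) * (z - w) * invOneAddSq w) ≤ M.l2Norm (z - w) := by
    refine (l2Norm_mul_le_right _ _).trans ?_
    refine (mul_le_of_le_one_right (l2Norm_nonneg _) (norm_invOneAddSq_le_one _)).trans ?_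
    exact (l2Norm_mul_le_left _ _).trans (mul_le_of_le_one_left h0 (norm_invOneAddSq_le_one _))
  have h2 : M.l2Norm (unitBallMap z * star (w - z) * unitBallMap w) ≤ M.l2Norm (z - w) := by
    refine (l2Norm_mul_le_right _ _).trans ?_
    refine (mul_le_of_le_one_right (l2Norm_nonneg _) (norm_unitBallMap_le_one _)).trans ?_
    rw [l2Norm_sub_comm z w, ← l2Norm_star (w - z)]
    exact (l2Norm_mul_le_left _ _).trans
      (mul_le_of_le_one_left (l2Norm_nonneg _) (norm_unitBallMap_le_one _))
  rw [unitBallMap_sub]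
  refine (l2Norm_add_le _ _).trans ?_
  rw [l2Norm_smul, l2Norm_smul]
  norm_num [-star_sub]
  linarith

end TracialWStarAlgebra

end

noncomputable section

/-! ### Bounds on terms and formulas, and connectives applied to definable predicates -/

lemma exists_norm_freeAlgebra_lift_le {κ : Type*} (C : κ → ℝ) (p : FreeAlgebra ℂ κ) :
    ∃ B : ℝ, ∀ (M : TracialWStarAlgebra.{u}) (a : κ → M), (∀ i, ‖a i‖ ≤ C i) →
      ‖FreeAlgebra.lift ℂ a p‖ ≤ B := by
  induction p using FreeAlgebra.induction with
  | grade0 c =>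
    refine ⟨‖c‖, fun M a _ => ?_⟩
    rw [AlgHom.commutes, norm_algebraMap']
  | grade1 i => exact ⟨C i, fun M a ha => by simpa using ha i⟩
  | mul p q hp hq =>
    obtain ⟨B, hB⟩ := hp
    obtain ⟨B', hB'⟩ := hq
    refine ⟨B * B', fun M a ha => ?_⟩
    rw [map_mul]
    exact (norm_mul_le _ _).trans (mul_le_mul (hB M a ha) (hB' M a ha) (norm_nonneg _)
      ((norm_nonneg _).trans (hB M a ha)))
  | add p q hp hq =>
    obtain ⟨B, hB⟩ := hp
    obtain ⟨B', hB'⟩ := hq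
    refine ⟨B + B', fun M a ha => ?_⟩
    rw [map_add]
    exact (norm_add_le _ _).trans (add_le_add (hB M a ha) (hB' M a ha))

variable {ι : Type}

lemma TrTerm.exists_norm_eval_le (t : TrTerm ι) (r : ι → ℝ) :
    ∃ B : ℝ, ∀ (M : TracialWStarAlgebra.{u}) (X : ι → M), (∀ i, ‖X i‖ ≤ r i) →
      ‖t.eval M X‖ ≤ B := by
  induction t with
  | var i => exact ⟨r i, fun M X hX => hX i⟩
  | zero => exact ⟨0, fun M X _ => by simp [TrTerm.eval]⟩
  | one => exact ⟨1, fun M X _ => by simp [TrTerm.eval]⟩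
  | add s t hs ht =>
    obtain ⟨B, hB⟩ := hs
    obtain ⟨B', hB'⟩ := ht
    exact ⟨B + B', fun M X hX => (norm_add_le _ _).trans (add_le_add (hB M X hX) (hB' M X hX))⟩
  | mul s t hs ht =>
    obtain ⟨B, hB⟩ := hs
    obtain ⟨B', hB'⟩ := ht
    exact ⟨B * B', fun M X hX => (norm_mul_le _ _).trans (mul_le_mul (hB M X hX) (hB' M X hX)
      (norm_nonneg _) ((norm_nonneg _).trans (hB M X hX)))⟩
  | star t ht =>
    obtain ⟨B, hB⟩ := ht
    exact ⟨B, fun M X hX => by simpa [TrTerm.eval] using hB M X hX⟩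
  | smul c t ht =>
    obtain ⟨B, hB⟩ := ht
    refine ⟨‖c‖ * B, fun M X hX => ?_⟩
    rw [TrTerm.eval, norm_smul]
    exact mul_le_mul_of_nonneg_left (hB M X hX) (norm_nonneg _)
  | poly n p t ht =>
    choose B hB using ht
    obtain ⟨B', hB'⟩ := exists_norm_freeAlgebra_lift_le B p
    exact ⟨B', fun M X hX => hB' M _ fun i => hB i M X hX⟩

lemma exists_abs_le_of_continuous {n : ℕ} {F : (Fin n → ℝ) → ℝ} (hF : Continuous F)
    (B : Fin n → ℝ) : ∃ B' : ℝ, ∀ x : Fin n → ℝ, (∀ i, |x i| ≤ B i) → |F x| ≤ B' := by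
  obtain ⟨B', hB'⟩ := (isCompact_Icc (a := -B) (b := B)).exists_bound_of_continuousOn
    hF.continuousOn
  exact ⟨B', fun x hx => hB' x ⟨fun i => (abs_le.1 (hx i)).1, fun i => (abs_le.1 (hx i)).2⟩⟩

lemma QFFormula.exists_abs_eval_le (ψ : QFFormula ι) (r : ι → ℝ) :
    ∃ B : ℝ, ∀ (M : TracialWStarAlgebra.{u}) (X : ι → M), (∀ i, ‖X i‖ ≤ r i) →
      |ψ.eval M X| ≤ B := by
  induction ψ with
  | reTr t =>
    obtain ⟨B, hB⟩ := t.exists_norm_eval_le r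
    exact ⟨B, fun M X hX => (Complex.abs_re_le_norm _).trans
      ((norm_tr_le _).trans ((l2Norm_le_norm _).trans (hB M X hX)))⟩
  | imTr t =>
    obtain ⟨B, hB⟩ := t.exists_norm_eval_le r
    exact ⟨B, fun M X hX => (Complex.abs_im_le_norm _).trans
      ((norm_tr_le _).trans ((l2Norm_le_norm _).trans (hB M X hX)))⟩
  | dist s t =>
    obtain ⟨B, hB⟩ := s.exists_norm_eval_le r
    obtain ⟨B', hB'⟩ := t.exists_norm_eval_le r
    refine ⟨B + B', fun M X hX => ?_⟩
    rw [QFFormula.eval, l2Dist_eq_l2Norm, abs_of_nonneg (l2Norm_nonneg _)]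
    exact (l2Norm_le_norm _).trans ((norm_sub_le _ _).trans (add_le_add (hB M X hX) (hB' M X hX)))
  | conn n F hF φ h =>
    choose B hB using h
    obtain ⟨B', hB'⟩ := exists_abs_le_of_continuous hF B
    exact ⟨B', fun M X hX => hB' _ fun i => hB i M X hX⟩

namespace IsQFDefinablePredicate

lemma of_formula (ψ : QFFormula ι) :
    IsQFDefinablePredicate fun (M : TracialWStarAlgebra.{u}) X => ψ.eval M X :=
  fun _ _ _ hε => ⟨ψ, fun M X _ => by simpa using hε⟩

lemma exists_abs_le {φ : ∀ M : TracialWStarAlgebra.{u}, (ι → M) → ℝ}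
    (hφ : IsQFDefinablePredicate φ) {r : ι → ℝ} (hr : ∀ i, 0 < r i) :
    ∃ B : ℝ, 0 < B ∧ ∀ (M : TracialWStarAlgebra.{u}) (X : ι → M), (∀ i, ‖X i‖ ≤ r i) →
      |φ M X| ≤ B := by
  obtain ⟨ψ, hψ⟩ := hφ r hr 1 one_pos
  obtain ⟨B, hB⟩ := ψ.exists_abs_eval_le.{u} r
  refine ⟨|B| + 1, by positivity, fun M X hX => ?_⟩
  have h1 := hψ M X hX
  have h2 := hB M X hX
  have h3 := abs_sub_abs_le_abs_sub (φ M X) (ψ.eval M X)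
  linarith [le_abs_self B]

lemma of_approx {φ : ∀ M : TracialWStarAlgebra.{u}, (ι → M) → ℝ}
    (h : ∀ r : ι → ℝ, (∀ i, 0 < r i) → ∀ ε : ℝ, 0 < ε →
      ∃ φ' : ∀ M : TracialWStarAlgebra.{u}, (ι → M) → ℝ, IsQFDefinablePredicate φ' ∧
        ∀ (M : TracialWStarAlgebra.{u}) (X : ι → M), (∀ i, ‖X i‖ ≤ r i) →
          |φ M X - φ' M X| < ε) : IsQFDefinablePredicate φ := by
  intro r hr ε hε
  obtain ⟨φ', hφ', h1⟩ := h r hr (ε / 2) (half_pos hε)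
  obtain ⟨ψ, hψ⟩ := hφ' r hr (ε / 2) (half_pos hε)
  refine ⟨ψ, fun M X hX => ?_⟩
  have := abs_sub_le (φ M X) (φ' M X) (ψ.eval M X)
  linarith [h1 M X hX, hψ M X hX]

/-- Continuous connectives preserve quantifier-free definability. -/
lemma conn {n : ℕ} {F : (Fin n → ℝ) → ℝ} (hF : Continuous F)
    {φ : Fin n → ∀ M : TracialWStarAlgebra.{u}, (ι → M) → ℝ}
    (hφ : ∀ i, IsQFDefinablePredicate (φ i)) :
    IsQFDefinablePredicate fun (M : TracialWStarAlgebra.{u}) X => F fun i => φ i M X := by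
  intro r hr ε hε
  choose B hB0 hB using fun i => (hφ i).exists_abs_le hr
  -- The margin 1 leaves room for the values of the approximating formulas.
  have hK : IsCompact (Set.Icc (fun i => -(B i + 1)) (fun i => B i + 1)) := isCompact_Icc
  obtain ⟨δ, hδ, hF'⟩ := Metric.uniformContinuousOn_iff.1
    (hK.uniformContinuousOn_of_continuous hF.continuousOn) ε hε
  choose ψ hψ using fun i => hφ i r hr (min δ 1) (lt_min hδ one_pos)
  refine ⟨.conn n F hF ψ, fun M X hX => ?_⟩
  have h1 (i : Fin n) := abs_lt.1 ((hψ i M X hX).trans_le (min_le_right _ _))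
  have h2 (i : Fin n) := abs_le.1 (hB i M X hX)
  refine hF' _ ⟨fun i => ?_, fun i => ?_⟩ _ ⟨fun i => ?_, fun i => ?_⟩ ?_
  · dsimp only; linarith [(h2 i).1]
  · dsimp only; linarith [(h2 i).2]
  · dsimp only; linarith [(h2 i).1, (h1 i).2]
  · dsimp only; linarith [(h2 i).2, (h1 i).1]
  · exact (dist_pi_lt_iff hδ).2 fun i => (hψ i M X hX).trans_le (min_le_left _ _)

lemma const (c : ℝ) : IsQFDefinablePredicate fun (M : TracialWStarAlgebra.{u}) (_ : ι → M) => c :=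
  conn (n := 0) (F := fun _ => c) continuous_const (φ := fun i => i.elim0) fun i => i.elim0

variable {φ φ' : ∀ M : TracialWStarAlgebra.{u}, (ι → M) → ℝ}

lemma comp_continuous (hφ : IsQFDefinablePredicate φ) {F : ℝ → ℝ} (hF : Continuous F) :
    IsQFDefinablePredicate fun (M : TracialWStarAlgebra.{u}) X => F (φ M X) :=
  conn (n := 1) (F := fun x => F (x 0)) (by fun_prop) (φ := fun _ => φ) fun _ => hφ

lemma comp_continuous₂ (hφ : IsQFDefinablePredicate φ) (hφ' : IsQFDefinablePredicate φ')
    {F : ℝ × ℝ → ℝ} (hF : Continuous F) :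
    IsQFDefinablePredicate fun (M : TracialWStarAlgebra.{u}) X => F (φ M X, φ' M X) :=
  conn (n := 2) (F := fun x => F (x 0, x 1)) (by fun_prop) (φ := ![φ, φ']) fun i => by
    fin_cases i
    · exact hφ
    · exact hφ'

lemma add (hφ : IsQFDefinablePredicate φ) (hφ' : IsQFDefinablePredicate φ') :
    IsQFDefinablePredicate fun (M : TracialWStarAlgebra.{u}) X => φ M X + φ' M X :=
  hφ.comp_continuous₂ hφ' (F := fun x => x.1 + x.2) (by fun_prop)

lemma mul (hφ : IsQFDefinablePredicate φ) (hφ' : IsQFDefinablePredicate φ') :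
    IsQFDefinablePredicate fun (M : TracialWStarAlgebra.{u}) X => φ M X * φ' M X :=
  hφ.comp_continuous₂ hφ' (F := fun x => x.1 * x.2) (by fun_prop)

end IsQFDefinablePredicate

/-! ### Definable elements -/

/-- The sums of products of definable predicates and terms. -/
def qfSimple (ι : Type) : AddSubmonoid (∀ M : TracialWStarAlgebra.{u}, (ι → M) → M) :=
  AddSubmonoid.closure {g | ∃ (φ : ∀ M : TracialWStarAlgebra.{u}, (ι → M) → ℝ) (t : TrTerm ι),
    IsQFDefinablePredicate φ ∧ g = fun M X => (φ M X : ℂ) • t.eval M X}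

/-- A family of maps `L^∞(M)^ι → L^∞(M)`, bounded on products of norm balls and approximated there
in `‖·‖₂` by sums of products of definable predicates and terms. -/
structure IsQFDefinableElement (g : ∀ M : TracialWStarAlgebra.{u}, (ι → M) → M) : Prop where
  exists_norm_le : ∀ r : ι → ℝ, (∀ i, 0 < r i) → ∃ B : ℝ, 0 < B ∧
    ∀ (M : TracialWStarAlgebra.{u}) (X : ι → M), (∀ i, ‖X i‖ ≤ r i) → ‖g M X‖ ≤ B
  approx : ∀ r : ι → ℝ, (∀ i, 0 < r i) → ∀ ε : ℝ, 0 < ε → ∃ s ∈ qfSimple ι,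
    ∀ (M : TracialWStarAlgebra.{u}) (X : ι → M), (∀ i, ‖X i‖ ≤ r i) →
      M.l2Norm (g M X - s M X) < ε

lemma qfSimple_single {φ : ∀ M : TracialWStarAlgebra.{u}, (ι → M) → ℝ}
    (hφ : IsQFDefinablePredicate φ) (t : TrTerm ι) :
    (fun (M : TracialWStarAlgebra.{u}) X => (φ M X : ℂ) • t.eval M X) ∈ qfSimple ι :=
  AddSubmonoid.subset_closure ⟨φ, t, hφ, rfl⟩

lemma qfSimple_star {s : ∀ M : TracialWStarAlgebra.{u}, (ι → M) → M} (hs : s ∈ qfSimple ι) :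
    (fun M X => star (s M X)) ∈ qfSimple ι := by
  induction hs using AddSubmonoid.closure_induction with
  | mem g hg =>
    obtain ⟨φ, t, hφ, rfl⟩ := hg
    convert! qfSimple_single hφ t.star using 3
    simp [TrTerm.eval, star_smul]
  | zero =>
    convert! (qfSimple ι).zero_mem using 3
    exact star_zero _
  | add g h _ _ hg hh =>
    convert! (qfSimple ι).add_mem hg hh using 3
    exact star_add _ _

lemma qfSimple_smul {s : ∀ M : TracialWStarAlgebra.{u}, (ι → M) → M} (hs : s ∈ qfSimple ι)
    (c : ℂ) {ψ : ∀ M : TracialWStarAlgebra.{u}, (ι → M) → ℝ} (hψ : IsQFDefinablePredicate ψ) :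
    (fun M X => (c * ψ M X) • s M X) ∈ qfSimple ι := by
  induction hs using AddSubmonoid.closure_induction with
  | mem g hg =>
    obtain ⟨φ, t, hφ, rfl⟩ := hg
    convert! qfSimple_single (hψ.mul hφ) (t.smul c) using 3
    simp only [TrTerm.eval, smul_smul, Complex.ofReal_mul]
    congr 1
    ring
  | zero =>
    convert! (qfSimple ι).zero_mem using 3
    exact smul_zero _
  | add g h _ _ hg hh =>
    convert! (qfSimple ι).add_mem hg hh using 3
    exact smul_add _ _ _

lemma qfSimple_mul {s s' : ∀ M : TracialWStarAlgebra.{u}, (ι → M) → M} (hs : s ∈ qfSimple ι)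
    (hs' : s' ∈ qfSimple ι) : (fun M X => s M X * s' M X) ∈ qfSimple ι := by
  induction hs using AddSubmonoid.closure_induction with
  | mem g hg =>
    obtain ⟨φ, t, hφ, rfl⟩ := hg
    induction hs' using AddSubmonoid.closure_induction with
    | mem g hg =>
      obtain ⟨φ', t', hφ', rfl⟩ := hg
      convert! qfSimple_single (hφ.mul hφ') (t.mul t') using 3
      simp only [TrTerm.eval, smul_mul_smul_comm, Complex.ofReal_mul]
    | zero =>
      convert! (qfSimple ι).zero_mem using 3
      exact mul_zero _
    | add g h _ _ hg hh =>
      convert! (qfSimple ι).add_mem hg hh using 3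
      exact mul_add _ _ _
  | zero =>
    convert! (qfSimple ι).zero_mem using 3
    exact zero_mul _
  | add g h _ _ hg hh =>
    convert! (qfSimple ι).add_mem hg hh using 3
    exact add_mul _ _ _

lemma exists_norm_le_of_mem_qfSimple {s : ∀ M : TracialWStarAlgebra.{u}, (ι → M) → M}
    (hs : s ∈ qfSimple ι) {r : ι → ℝ} (hr : ∀ i, 0 < r i) : ∃ B : ℝ, 0 < B ∧
      ∀ (M : TracialWStarAlgebra.{u}) (X : ι → M), (∀ i, ‖X i‖ ≤ r i) → ‖s M X‖ ≤ B := by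
  induction hs using AddSubmonoid.closure_induction with
  | mem g hg =>
    obtain ⟨φ, t, hφ, rfl⟩ := hg
    obtain ⟨B, hB0, hB⟩ := hφ.exists_abs_le hr
    obtain ⟨B', hB'⟩ := t.exists_norm_eval_le.{u} r
    refine ⟨B * (|B'| + 1), by positivity, fun M X hX => ?_⟩
    rw [norm_smul, Complex.norm_real]
    exact mul_le_mul (hB M X hX) ((hB' M X hX).trans (by linarith [le_abs_self B']))
      (norm_nonneg _) hB0.le
  | zero => exact ⟨1, one_pos, fun M X _ => by simp⟩
  | add g h _ _ hg hh =>
    obtain ⟨B, hB0, hB⟩ := hg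
    obtain ⟨B', hB'0, hB'⟩ := hh
    exact ⟨B + B', add_pos hB0 hB'0, fun M X hX =>
      (norm_add_le _ _).trans (add_le_add (hB M X hX) (hB' M X hX))⟩

lemma isQFDefinablePredicate_tr_of_mem_qfSimple
    {s : ∀ M : TracialWStarAlgebra.{u}, (ι → M) → M} (hs : s ∈ qfSimple ι) :
    IsQFDefinablePredicate (fun M X => (M.tr (s M X)).re) ∧
      IsQFDefinablePredicate (fun M X => (M.tr (s M X)).im) := by
  induction hs using AddSubmonoid.closure_induction with
  | mem g hg =>
    obtain ⟨φ, t, hφ, rfl⟩ := hg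
    constructor
    · simpa [QFFormula.eval] using hφ.mul (.of_formula (.reTr t))
    · simpa [QFFormula.eval] using hφ.mul (.of_formula (.imTr t))
  | zero => simpa using IsQFDefinablePredicate.const 0
  | add g h _ _ hg hh =>
    constructor
    · simpa using hg.1.add hh.1
    · simpa using hg.2.add hh.2

/-! ### Closure properties of definable elements -/

namespace IsQFDefinableElement

lemma of_mem_qfSimple {s : ∀ M : TracialWStarAlgebra.{u}, (ι → M) → M} (hs : s ∈ qfSimple ι) :
    IsQFDefinableElement s where
  exists_norm_le _ hr := exists_norm_le_of_mem_qfSimple hs hr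
  approx _ _ _ hε := ⟨s, hs, fun M X _ => by simpa using hε⟩

lemma of_term (t : TrTerm ι) :
    IsQFDefinableElement fun (M : TracialWStarAlgebra.{u}) X => t.eval M X := by
  refine of_mem_qfSimple ?_
  convert! qfSimple_single (.const 1) t using 3
  simp

lemma of_approx {g : ∀ M : TracialWStarAlgebra.{u}, (ι → M) → M}
    (hg : ∀ r : ι → ℝ, (∀ i, 0 < r i) → ∃ B : ℝ, 0 < B ∧
      ∀ (M : TracialWStarAlgebra.{u}) (X : ι → M), (∀ i, ‖X i‖ ≤ r i) → ‖g M X‖ ≤ B)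
    (h : ∀ r : ι → ℝ, (∀ i, 0 < r i) → ∀ ε : ℝ, 0 < ε →
      ∃ g' : ∀ M : TracialWStarAlgebra.{u}, (ι → M) → M, IsQFDefinableElement g' ∧
        ∀ (M : TracialWStarAlgebra.{u}) (X : ι → M), (∀ i, ‖X i‖ ≤ r i) →
          M.l2Norm (g M X - g' M X) < ε) : IsQFDefinableElement g where
  exists_norm_le := hg
  approx r hr ε hε := by
    obtain ⟨g', hg', h1⟩ := h r hr (ε / 2) (half_pos hε)
    obtain ⟨s, hs, h2⟩ := hg'.approx r hr (ε / 2) (half_pos hε)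
    refine ⟨s, hs, fun M X hX => ?_⟩
    linarith [l2Norm_sub_le (g M X) (g' M X) (s M X), h1 M X hX, h2 M X hX]

variable {g h : ∀ M : TracialWStarAlgebra.{u}, (ι → M) → M}

lemma add (hg : IsQFDefinableElement g) (hh : IsQFDefinableElement h) :
    IsQFDefinableElement fun M X => g M X + h M X where
  exists_norm_le r hr := by
    obtain ⟨B, hB0, hB⟩ := hg.exists_norm_le r hr
    obtain ⟨B', hB'0, hB'⟩ := hh.exists_norm_le r hr
    exact ⟨B + B', add_pos hB0 hB'0, fun M X hX =>
      (norm_add_le _ _).trans (add_le_add (hB M X hX) (hB' M X hX))⟩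
  approx r hr ε hε := by
    obtain ⟨s, hs, h1⟩ := hg.approx r hr (ε / 2) (half_pos hε)
    obtain ⟨s', hs', h2⟩ := hh.approx r hr (ε / 2) (half_pos hε)
    refine ⟨s + s', add_mem hs hs', fun M X hX => ?_⟩
    have := l2Norm_add_le (g M X - s M X) (h M X - s' M X)
    rw [sub_add_sub_comm] at this
    exact this.trans_lt (by linarith [h1 M X hX, h2 M X hX])

lemma mul (hg : IsQFDefinableElement g) (hh : IsQFDefinableElement h) :
    IsQFDefinableElement fun M X => g M X * h M X where
  exists_norm_le r hr := by
    obtain ⟨B, hB0, hB⟩ := hg.exists_norm_le r hr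
    obtain ⟨B', hB'0, hB'⟩ := hh.exists_norm_le r hr
    exact ⟨B * B', mul_pos hB0 hB'0, fun M X hX => (norm_mul_le _ _).trans
      (mul_le_mul (hB M X hX) (hB' M X hX) (norm_nonneg _) hB0.le)⟩
  approx r hr ε hε := by
    obtain ⟨B, hB0, hB⟩ := hg.exists_norm_le r hr
    -- The order matters: approximants carry no prescribed norm bound, so `s` is chosen after the
    -- bound `B'` of `s'` is known.
    obtain ⟨s', hs', h2⟩ := hh.approx r hr (ε / 2 / B) (by positivity)
    obtain ⟨B', hB'0, hB'⟩ := exists_norm_le_of_mem_qfSimple hs' hr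
    obtain ⟨s, hs, h1⟩ := hg.approx r hr (ε / 2 / B') (by positivity)
    refine ⟨_, qfSimple_mul hs hs', fun M X hX => ?_⟩
    have h3 : g M X * h M X - s M X * s' M X =
        g M X * (h M X - s' M X) + (g M X - s M X) * s' M X := by noncomm_ring
    have h4 : M.l2Norm (g M X * (h M X - s' M X)) < ε / 2 := by
      refine (l2Norm_mul_le_left _ _).trans_lt ?_
      refine (mul_le_mul_of_nonneg_right (hB M X hX) (l2Norm_nonneg _)).trans_lt ?_
      rw [mul_comm]
      exact (lt_div_iff₀ hB0).1 (h2 M X hX)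
    have h5 : M.l2Norm ((g M X - s M X) * s' M X) < ε / 2 := by
      refine (l2Norm_mul_le_right _ _).trans_lt ?_
      refine (mul_le_mul_of_nonneg_left (hB' M X hX) (l2Norm_nonneg _)).trans_lt ?_
      exact (lt_div_iff₀ hB'0).1 (h1 M X hX)
    rw [h3]
    exact (l2Norm_add_le _ _).trans_lt (by linarith)

lemma star (hg : IsQFDefinableElement g) : IsQFDefinableElement fun M X => star (g M X) where
  exists_norm_le r hr := by simpa using hg.exists_norm_le r hr
  approx r hr ε hε := by
    obtain ⟨s, hs, h1⟩ := hg.approx r hr ε hε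
    refine ⟨_, qfSimple_star hs, fun M X hX => ?_⟩
    rw [← star_sub, l2Norm_star]
    exact h1 M X hX

lemma mul_smul (hg : IsQFDefinableElement g) (c : ℂ)
    {φ : ∀ M : TracialWStarAlgebra.{u}, (ι → M) → ℝ} (hφ : IsQFDefinablePredicate φ) :
    IsQFDefinableElement fun M X => (c * φ M X) • g M X := by
  have hbd (r : ι → ℝ) (hr : ∀ i, 0 < r i) : ∃ B : ℝ, 0 < B ∧
      ∀ (M : TracialWStarAlgebra.{u}) (X : ι → M), (∀ i, ‖X i‖ ≤ r i) → ‖c * φ M X‖ ≤ B := by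
    obtain ⟨B, hB0, hB⟩ := hφ.exists_abs_le hr
    refine ⟨(‖c‖ + 1) * B, by positivity, fun M X hX => ?_⟩
    rw [norm_mul, Complex.norm_real]
    exact mul_le_mul (by linarith) (hB M X hX) (norm_nonneg _) (by positivity)
  refine ⟨fun r hr => ?_, fun r hr ε hε => ?_⟩
  · obtain ⟨B, hB0, hB⟩ := hbd r hr
    obtain ⟨B', hB'0, hB'⟩ := hg.exists_norm_le r hr
    refine ⟨B * B', mul_pos hB0 hB'0, fun M X hX => ?_⟩
    rw [norm_smul]
    exact mul_le_mul (hB M X hX) (hB' M X hX) (norm_nonneg _) hB0.le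
  · obtain ⟨B, hB0, hB⟩ := hbd r hr
    obtain ⟨s, hs, h1⟩ := hg.approx r hr (ε / B) (by positivity)
    refine ⟨_, qfSimple_smul hs c hφ, fun M X hX => ?_⟩
    rw [← smul_sub, l2Norm_smul]
    refine (mul_le_mul_of_nonneg_right (hB M X hX) (l2Norm_nonneg _)).trans_lt ?_
    rw [mul_comm]
    exact (lt_div_iff₀ hB0).1 (h1 M X hX)

lemma smul (hg : IsQFDefinableElement g) (c : ℂ) : IsQFDefinableElement fun M X => c • g M X := by
  simpa using hg.mul_smul c (.const 1)

lemma zero : IsQFDefinableElement fun (M : TracialWStarAlgebra.{u}) (_ : ι → M) => (0 : M) :=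
  of_term .zero

lemma one : IsQFDefinableElement fun (M : TracialWStarAlgebra.{u}) (_ : ι → M) => (1 : M) :=
  of_term .one

lemma sub (hg : IsQFDefinableElement g) (hh : IsQFDefinableElement h) :
    IsQFDefinableElement fun M X => g M X - h M X := by
  simpa [sub_eq_add_neg] using hg.add (hh.smul (-1))

lemma pow (hg : IsQFDefinableElement g) (n : ℕ) : IsQFDefinableElement fun M X => g M X ^ n := by
  induction n with
  | zero => simpa using one
  | succ n ih => simpa [pow_succ] using ih.mul hg

lemma sum_range {g : ℕ → ∀ M : TracialWStarAlgebra.{u}, (ι → M) → M}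
    (hg : ∀ k, IsQFDefinableElement (g k)) (n : ℕ) :
    IsQFDefinableElement fun M X => ∑ k ∈ Finset.range n, g k M X := by
  induction n with
  | zero => simpa using zero
  | succ n ih => simpa [Finset.sum_range_succ] using ih.add (hg n)

lemma re_tr (hg : IsQFDefinableElement g) :
    IsQFDefinablePredicate fun M X => (M.tr (g M X)).re := by
  refine .of_approx fun r hr ε hε => ?_
  obtain ⟨s, hs, h⟩ := hg.approx r hr ε hε
  refine ⟨_, (isQFDefinablePredicate_tr_of_mem_qfSimple hs).1, fun M X hX => ?_⟩
  rw [← Complex.sub_re, ← map_sub]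
  exact (Complex.abs_re_le_norm _).trans_lt ((norm_tr_le _).trans_lt (h M X hX))

lemma im_tr (hg : IsQFDefinableElement g) :
    IsQFDefinablePredicate fun M X => (M.tr (g M X)).im := by
  refine .of_approx fun r hr ε hε => ?_
  obtain ⟨s, hs, h⟩ := hg.approx r hr ε hε
  refine ⟨_, (isQFDefinablePredicate_tr_of_mem_qfSimple hs).2, fun M X hX => ?_⟩
  rw [← Complex.sub_im, ← map_sub]
  exact (Complex.abs_im_le_norm _).trans_lt ((norm_tr_le _).trans_lt (h M X hX))

lemma l2Norm (hg : IsQFDefinableElement g) :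
    IsQFDefinablePredicate fun M X => M.l2Norm (g M X) :=
  (hg.star.mul hg).re_tr.comp_continuous Real.continuous_sqrt

/-! ### Substitution of definable elements -/

variable {κ : Type} {a : κ → ∀ M : TracialWStarAlgebra.{u}, (ι → M) → M}

lemma freeAlgebra_lift (ha : ∀ k, IsQFDefinableElement (a k)) (p : FreeAlgebra ℂ κ) :
    IsQFDefinableElement fun M X => FreeAlgebra.lift ℂ (fun k => a k M X) p := by
  induction p using FreeAlgebra.induction with
  | grade0 c => simpa [Algebra.algebraMap_eq_smul_one] using one.smul c
  | grade1 k => simpa using ha k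
  | mul p q hp hq => simpa using hp.mul hq
  | add p q hp hq => simpa using hp.add hq

lemma term_eval (ha : ∀ k, IsQFDefinableElement (a k)) (t : TrTerm κ) :
    IsQFDefinableElement fun M X => t.eval M fun k => a k M X := by
  induction t with
  | var k => exact ha k
  | zero => exact zero
  | one => exact one
  | add s t hs ht => exact hs.add ht
  | mul s t hs ht => exact hs.mul ht
  | star t ht => exact ht.star
  | smul c t ht => exact ht.smul c
  | poly n p t ht => exact freeAlgebra_lift ht p

lemma formula_eval (ha : ∀ k, IsQFDefinableElement (a k)) (ψ : QFFormula κ) :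
    IsQFDefinablePredicate fun M X => ψ.eval M fun k => a k M X := by
  induction ψ with
  | reTr t => exact (term_eval ha t).re_tr
  | imTr t => exact (term_eval ha t).im_tr
  | dist s t => exact ((term_eval ha s).sub (term_eval ha t)).l2Norm
  | conn n F hF φ h => exact .conn hF h

/-- The norm bounds of the `a k` supply the radii on which `φ` is replaced by a formula. -/
lemma predicate_comp (ha : ∀ k, IsQFDefinableElement (a k))
    {φ : ∀ M : TracialWStarAlgebra.{u}, (κ → M) → ℝ} (hφ : IsQFDefinablePredicate φ) :
    IsQFDefinablePredicate fun M X => φ M fun k => a k M X := by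
  refine .of_approx fun r hr ε hε => ?_
  choose B hB0 hB using fun k => (ha k).exists_norm_le r hr
  obtain ⟨ψ, hψ⟩ := hφ B hB0 ε hε
  exact ⟨_, formula_eval ha ψ, fun M X hX => hψ M _ fun k => hB k M X hX⟩

lemma invOneAddSq (hg : IsQFDefinableElement g) :
    IsQFDefinableElement fun M X => invOneAddSq (g M X) := by
  refine .of_approx (fun r hr => ⟨1, one_pos, fun M X _ => norm_invOneAddSq_le_one _⟩)
    fun r hr ε hε => ?_
  obtain ⟨B, hB0, hB⟩ := hg.exists_norm_le r hr
  obtain ⟨n, hn⟩ := exists_pow_lt_of_lt_one hε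
    ((div_lt_one (by positivity)).2 (lt_one_add (B ^ 2)) : B ^ 2 / (1 + B ^ 2) < 1)
  refine ⟨_, (sum_range (fun k => (((one.smul ((B ^ 2 : ℝ) : ℂ)).sub (hg.star.mul hg)).smul
    ((1 + (B ^ 2 : ℝ))⁻¹ : ℂ)).pow k) n).smul ((1 + (B ^ 2 : ℝ))⁻¹ : ℂ), fun M X hX => ?_⟩
  refine (l2Norm_le_norm _).trans_lt (lt_of_le_of_lt ?_ hn)
  exact norm_invOneAddSq_sub_sum_le (pow_le_pow_left₀ (norm_nonneg _) (hB M X hX) 2) n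

lemma unitBallMap (hg : IsQFDefinableElement g) :
    IsQFDefinableElement fun M X => unitBallMap (g M X) :=
  (hg.mul hg.invOneAddSq).smul 2

end IsQFDefinableElement

end

noncomputable section

namespace TracialWStarAlgebra

variable {M : TracialWStarAlgebra.{u}}

/-! ### Forced limits -/

/-- The sequence that follows `g`, the `n`-th step being shortened to length at most `2⁻ⁿ`
in `‖·‖₂`. -/
def forcedSeq (g : ℕ → M) : ℕ → M
  | 0 => g 0
  | n + 1 => forcedSeq g n +
      (((1 / 2) ^ n / max ((1 / 2) ^ n) (M.l2Norm (g (n + 1) - forcedSeq g n)) : ℝ) : ℂ) •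
        (g (n + 1) - forcedSeq g n)

lemma div_max_mem_Icc {c : ℝ} (hc : 0 < c) (t : ℝ) : 0 ≤ c / max c t ∧ c / max c t ≤ 1 :=
  ⟨div_nonneg hc.le (hc.le.trans (le_max_left _ _)),
    div_le_one_of_le₀ (le_max_left _ _) (hc.le.trans (le_max_left _ _))⟩

/-- Each new term is a convex combination of the preceding one and `g (n + 1)`. -/
lemma norm_forcedSeq_le {g : ℕ → M} {R : ℝ} (hg : ∀ n, ‖g n‖ ≤ R) (n : ℕ) :
    ‖forcedSeq g n‖ ≤ R := by
  induction n with
  | zero => exact hg 0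
  | succ n ih =>
    rw [forcedSeq]
    set s : ℝ := (1 / 2) ^ n / max ((1 / 2) ^ n) (M.l2Norm (g (n + 1) - forcedSeq g n))
    obtain ⟨h0, h1⟩ : 0 ≤ s ∧ s ≤ 1 := div_max_mem_Icc (by positivity) _
    have h2 : forcedSeq g n + (s : ℂ) • (g (n + 1) - forcedSeq g n) =
        ((1 - s : ℝ) : ℂ) • forcedSeq g n + (s : ℂ) • g (n + 1) := by
      push_cast
      module
    rw [h2]
    refine (norm_add_le _ _).trans ?_
    rw [norm_smul, norm_smul, Complex.norm_of_nonneg h0, Complex.norm_of_nonneg (sub_nonneg.2 h1)]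
    nlinarith [mul_le_mul_of_nonneg_left ih (sub_nonneg.2 h1),
      mul_le_mul_of_nonneg_left (hg (n + 1)) h0]

lemma l2Norm_forcedSeq_succ_sub_le (g : ℕ → M) (n : ℕ) :
    M.l2Norm (forcedSeq g (n + 1) - forcedSeq g n) ≤ (1 / 2) ^ n := by
  rw [forcedSeq, add_sub_cancel_left, l2Norm_smul]
  set c : ℝ := (1 / 2) ^ n
  have hc : 0 < c := by positivity
  set t := M.l2Norm (g (n + 1) - forcedSeq g n)
  rw [Complex.norm_of_nonneg (div_max_mem_Icc hc t).1, div_mul_eq_mul_div]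
  refine div_le_of_le_mul₀ (hc.le.trans (le_max_left _ _)) hc.le ?_
  exact mul_le_mul_of_nonneg_left (le_max_right _ _) hc.le

lemma l2Norm_forcedSeq_sub_le (g : ℕ → M) {n m : ℕ} (h : n ≤ m) :
    M.l2Norm (forcedSeq g n - forcedSeq g m) ≤ 2 * (1 / 2) ^ n := by
  -- The exact geometric tail is kept so that the induction on `m` closes.
  have : M.l2Norm (forcedSeq g n - forcedSeq g m) ≤ 2 * (1 / 2) ^ n - 2 * (1 / 2) ^ m := by
    induction m, h using Nat.le_induction with
    | base => simp
    | succ m _ ih =>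
      have h1 := l2Norm_sub_le (forcedSeq g n) (forcedSeq g m) (forcedSeq g (m + 1))
      have h2 := l2Norm_forcedSeq_succ_sub_le g m
      rw [l2Norm_sub_comm] at h2
      rw [pow_succ]
      linarith
  refine this.trans (sub_le_self _ (by positivity))

lemma forcedSeq_eq {g : ℕ → M} (hg : ∀ n, M.l2Norm (g (n + 1) - g n) ≤ (1 / 2) ^ n) (n : ℕ) :
    forcedSeq g n = g n := by
  induction n with
  | zero => rfl
  | succ n ih =>
    rw [forcedSeq, ih, max_eq_left (hg n), div_self (by positivity)]
    simp

lemma exists_forcedSeq_limit {g : ℕ → M} {R : ℝ} (hg : ∀ n, ‖g n‖ ≤ R) :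
    ∃ y : M, ‖y‖ ≤ R ∧ ∀ n, M.l2Norm (forcedSeq g n - y) ≤ 2 * (1 / 2) ^ n := by
  refine exists_l2_limit (norm_forcedSeq_le hg) ?_ fun n m h => l2Norm_forcedSeq_sub_le g h
  simpa using (tendsto_pow_atTop_nhds_zero_of_lt_one (by norm_num : (0 : ℝ) ≤ 1 / 2)
    (by norm_num)).const_mul 2

open Classical in
/-- The limit of `forcedSeq g` in the norm ball of radius `R`. -/
def forcedLim (R : ℝ) (g : ℕ → M) : M :=
  if h : ∀ n, ‖g n‖ ≤ R then (exists_forcedSeq_limit h).choose else 0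

lemma forcedLim_spec {g : ℕ → M} {R : ℝ} (hg : ∀ n, ‖g n‖ ≤ R) :
    ‖forcedLim R g‖ ≤ R ∧ ∀ n, M.l2Norm (forcedSeq g n - forcedLim R g) ≤ 2 * (1 / 2) ^ n := by
  rw [forcedLim, dif_pos hg]
  exact (exists_forcedSeq_limit hg).choose_spec

/-- At rate `2⁻ⁿ / 2` the increments stay below `2⁻ⁿ`, so no step is shortened. -/
lemma forcedLim_eq {g : ℕ → M} {R : ℝ} (hg : ∀ n, ‖g n‖ ≤ R) {y : M}
    (hy : ∀ n, M.l2Norm (g n - y) ≤ (1 / 2) ^ n / 2) : forcedLim R g = y := by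
  have h1 (n : ℕ) : M.l2Norm (g (n + 1) - g n) ≤ (1 / 2) ^ n := by
    have h2 := l2Norm_sub_le (g (n + 1)) y (g n)
    have h3 := hy n
    have h4 := hy (n + 1)
    rw [l2Norm_sub_comm] at h3
    rw [pow_succ] at h4
    have : (0 : ℝ) < (1 / 2) ^ n := by positivity
    linarith
  refine sub_eq_zero.1 (eq_zero_of_l2Norm_eq_zero (le_antisymm ?_ (l2Norm_nonneg _)))
  have hlim : Tendsto (fun n : ℕ => 3 * (1 / 2 : ℝ) ^ n) atTop (𝓝 0) := by
    simpa using (tendsto_pow_atTop_nhds_zero_of_lt_one (by norm_num : (0 : ℝ) ≤ 1 / 2)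
      (by norm_num)).const_mul 3
  refine ge_of_tendsto' hlim fun n => ?_
  have h2 := (forcedLim_spec hg).2 n
  have h3 := hy n
  rw [forcedSeq_eq h1, l2Norm_sub_comm] at h2
  have h4 := l2Norm_sub_le (forcedLim R g) (g n) y
  have : (0 : ℝ) < (1 / 2) ^ n := by positivity
  linarith

end TracialWStarAlgebra

/-! ### Definability of forced limits -/

namespace IsQFDefinableElement

variable {ι : Type} {g : ℕ → ∀ M : TracialWStarAlgebra.{u}, (ι → M) → M}

lemma forcedSeq (hg : ∀ n, IsQFDefinableElement (g n)) (n : ℕ) :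
    IsQFDefinableElement fun M X => forcedSeq (fun n => g n M X) n := by
  induction n with
  | zero => exact hg 0
  | succ n ih =>
    have h1 := (hg (n + 1)).sub ih
    -- The maximum keeps the denominator positive, so the shortening factor is a continuous
    -- connective applied to a definable `‖·‖₂`.
    have hF : Continuous fun t : ℝ => (1 / 2 : ℝ) ^ n / max ((1 / 2) ^ n) t :=
      continuous_const.div (by fun_prop) fun t =>
        (lt_max_of_lt_left (by positivity : (0 : ℝ) < (1 / 2) ^ n)).ne'
    simpa only [TracialWStarAlgebra.forcedSeq, one_mul] using
      ih.add (h1.mul_smul 1 (h1.l2Norm.comp_continuous hF))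

lemma forcedLim (hg : ∀ n, IsQFDefinableElement (g n)) {R : ℝ} (hR : 0 < R)
    (hgR : ∀ n (M : TracialWStarAlgebra.{u}) (X : ι → M), ‖g n M X‖ ≤ R) :
    IsQFDefinableElement fun M X => forcedLim R (fun n => g n M X) := by
  refine .of_approx (fun r _ => ⟨R, hR, fun M X _ => (forcedLim_spec fun n => hgR n M X).1⟩)
    fun r hr ε hε => ?_
  obtain ⟨n, hn⟩ := exists_pow_lt_of_lt_one (half_pos hε) (by norm_num : (1 / 2 : ℝ) < 1)
  refine ⟨_, forcedSeq hg n, fun M X _ => ?_⟩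
  rw [l2Norm_sub_comm]
  exact ((forcedLim_spec fun n => hgR n M X).2 n).trans_lt (by linarith)

end IsQFDefinableElement

/-! ### Approximation by terms -/

lemma exists_term_eval_eq {ι : Type} {M : TracialWStarAlgebra.{u}} {X : ι → M} {x : M}
    (hx : x ∈ StarAlgebra.adjoin ℂ (Set.range X)) : ∃ t : TrTerm ι, t.eval M X = x := by
  induction hx using StarAlgebra.adjoin_induction with
  | mem x hx =>
    obtain ⟨i, rfl⟩ := hx
    exact ⟨.var i, rfl⟩
  | algebraMap c => exact ⟨.smul c .one, (Algebra.algebraMap_eq_smul_one c).symm⟩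
  | add x y _ _ hx hy =>
    obtain ⟨s, rfl⟩ := hx
    obtain ⟨t, rfl⟩ := hy
    exact ⟨.add s t, rfl⟩
  | mul x y _ _ hx hy =>
    obtain ⟨s, rfl⟩ := hx
    obtain ⟨t, rfl⟩ := hy
    exact ⟨.mul s t, rfl⟩
  | star x _ hx =>
    obtain ⟨s, rfl⟩ := hx
    exact ⟨.star s, rfl⟩

/-- Evaluation at the vector `1` of `L²` is continuous for the strong operator topology and carries
the image of `x` to the vector `x`, whose length is `‖x‖₂`. -/
lemma TracialWStarAlgebra.Generates.exists_term_l2Norm_sub_lt {ι : Type}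
    {M : TracialWStarAlgebra.{u}} {X : ι → M} (hX : M.Generates X) (w : M) {ε : ℝ} (hε : 0 < ε) :
    ∃ t : TrTerm ι, M.l2Norm (t.eval M X - w) < ε := by
  let ev : (M.L2 →Lₚₜ[ℂ] M.L2) → M.L2 := fun T => T ((M.posTrace.toPreGNS 1 : _) : M.L2)
  have hev : Continuous ev := continuous_eval_const _
  have h1 (x : M) : ev (M.standardRep x) = ((M.posTrace.toPreGNS x : _) : M.L2) := by
    change M.posTrace.gnsNonUnitalStarAlgHom x _ = _
    rw [PositiveLinearMap.gnsNonUnitalStarAlgHom_apply_coe]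
    simp
  have h2 := image_closure_subset_closure_image hev (Set.mem_image_of_mem ev (hX w))
  obtain ⟨_, ⟨_, ⟨x, hx, rfl⟩, rfl⟩, hd⟩ := Metric.mem_closure_iff.1 h2 ε hε
  obtain ⟨t, rfl⟩ := exists_term_eval_eq hx
  refine ⟨t, ?_⟩
  rw [h1, h1, UniformSpace.Completion.dist_eq, dist_comm, dist_eq_norm, ← map_sub] at hd
  exact hd

end

/-! ### The proposition -/

theorem mainTheorem10 (M : TracialWStarAlgebra.{u}) (r r' : ℕ → ℝ)
    (hr : ∀ j, 0 < r j) (hr' : ∀ j, 0 < r' j)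
    (X Y : ℕ → M) (hX : ∀ j, ‖X j‖ ≤ r j) (hgen : M.Generates X) (hY : ∀ j, ‖Y j‖ ≤ r' j) :
    ∃ f : ∀ N : TracialWStarAlgebra.{u}, (ℕ → N) → (ℕ → N),
      IsQFDefinableFunction f ∧ f M X = Y ∧
        ∀ (N : TracialWStarAlgebra.{u}) (X' : ℕ → N) (k : ℕ), ‖f N X' k‖ ≤ r' k := by
  have hw (k : ℕ) : ∃ w : M, (r' k : ℂ) • unitBallMap w = Y k := by
    have h0 : (r' k : ℂ) ≠ 0 := by exact_mod_cast (hr' k).ne'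
    obtain ⟨w, hw⟩ := exists_unitBallMap_eq (y := ((r' k)⁻¹ : ℂ) • Y k) (by
      rw [norm_smul, norm_inv, Complex.norm_of_nonneg (hr' k).le]
      exact inv_mul_le_one_of_le₀ (hY k) (hr' k).le)
    exact ⟨w, by rw [hw, smul_smul, mul_inv_cancel₀ h0, one_smul]⟩
  choose w hw using hw
  -- The factor `r' k * 3` absorbs the scaling and the Lipschitz constant, leaving the rate that
  -- `forcedLim_eq` requires.
  have hε (k n : ℕ) : 0 < (1 / 2 : ℝ) ^ n / 2 / (r' k * 3) := by
    have := hr' k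
    positivity
  choose t ht using fun k n => hgen.exists_term_l2Norm_sub_lt (w k) (hε k n)
  let g (k n : ℕ) (N : TracialWStarAlgebra.{u}) (X' : ℕ → N) : N :=
    (r' k : ℂ) • unitBallMap ((t k n).eval N X')
  have hg (k n : ℕ) (N : TracialWStarAlgebra.{u}) (X' : ℕ → N) : ‖g k n N X'‖ ≤ r' k := by
    rw [norm_smul, Complex.norm_of_nonneg (hr' k).le]
    exact mul_le_of_le_one_right (hr' k).le (norm_unitBallMap_le_one _)
  have hbound (N : TracialWStarAlgebra.{u}) (X' : ℕ → N) (k : ℕ) :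
      ‖forcedLim (r' k) (fun n => g k n N X')‖ ≤ r' k :=
    (forcedLim_spec fun n => hg k n N X').1
  refine ⟨fun N X' k => forcedLim (r' k) fun n => g k n N X', ⟨?_, ?_⟩, ?_, hbound⟩
  · exact fun _ _ => ⟨r', hr', fun N X' _ => hbound N X'⟩
  · intro φ hφ
    have hvar (i : ℕ ⊕ ℕ) : IsQFDefinableElement
        fun (N : TracialWStarAlgebra.{u}) (Z : ℕ ⊕ ℕ → N) => Z i := .of_term (.var i)
    have hf (k : ℕ) : IsQFDefinableElement fun (N : TracialWStarAlgebra.{u}) (Z : ℕ ⊕ ℕ → N) =>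
        forcedLim (r' k) fun n => g k n N fun j => Z (Sum.inl j) :=
      .forcedLim (fun n => ((IsQFDefinableElement.term_eval (fun j => hvar (Sum.inl j))
        (t k n)).unitBallMap).smul (r' k)) (hr' k) fun n N Z => hg k n N _
    -- The first tuple is replaced by the forced limits; the second is left as variables.
    convert! IsQFDefinableElement.predicate_comp (κ := ℕ ⊕ ℕ)
      (a := Sum.elim (fun k N Z => forcedLim (r' k) fun n => g k n N fun j => Z (Sum.inl j))
        fun k N Z => Z (Sum.inr k)) ?_ hφ using 4 with N Z
    · ext i
      cases i <;> rfl
    · rintro (k | k)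
      · exact hf k
      · exact hvar _
  · funext k
    refine forcedLim_eq (fun n => hg k n M X) fun n => ?_
    simp only [g]
    rw [← hw k, ← smul_sub, l2Norm_smul, Complex.norm_of_nonneg (hr' k).le]
    have h1 := l2Norm_unitBallMap_sub_le ((t k n).eval M X) (w k)
    have h2 := (lt_div_iff₀ (by have := hr' k; positivity)).1 (ht k n)
    have h3 := mul_le_mul_of_nonneg_left h1 (hr' k).le
    linarith
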